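/- Let $X$ be a compact metric space, $\phi : X \to X$ a homeomorphism, $F : X \to \mathbb R$ a continuous function and $\beta \in \mathbb R$. Put $S_0(F)=0$, $S_k(F)=\sum_{j=0}^{k-1}F\circ\phi^j$ for $k\ge 1$, and $S_k(F)=-\sum_{j=1}^{|k|}F\circ\phi^{-j}$ for $k\le -1$. A Borel probability measure $m$ on $X$ is $e^{\beta F}$-conformal if $m(\phi(B))=\int_B e^{\beta F}\,\mathrm dm$ for all Borel sets $B\subseteq X$, and ergodic if $m(B)=0$ or $m(X\setminus B)=0$ for every Borel set $B$ with $\phi^{-1}(B)=B$. A periodic orbit with minimal period $p$ is $F$-cyclic if $\sum_{i=1}^{p}F(\phi^i(x))=0$ for $x$ in the orbit. Define, for $p\in\{1,2,\dots\}$, $$M_{I_p}=\{x:\ \phi^p(x)=x,\ \phi^j(x)\ne x \text{ for } 1\le j<p,\ S_p(F)(x)=0\},\qquad M_{I_\infty}=\Big\{x:\ \sum_{n\in\mathbb Z}e^{\beta S_n(F)(x)}<\infty\Big\},$$ $$M_I=M_{I_\infty}\cup\bigcup_{p\ge 1}M_{I_p},\qquad M_{II_1}=\Big\{x:\ \liminf_{n}\frac1n\sum_{j=1}^n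 e^{\beta S_j(F)(x)}>0\Big\}\setminus M_I .$$ Let $M_{III}$ be a Borel set with $\phi^{-1}(M_{III})=M_{III}$ such that (a) there is a Borel function $u:X\setminus M_{III}\to\mathbb R$ with $\beta F=u\circ\phi-u$ on $X\setminus M_{III}$, and (b) $m(A)=0$ whenever $A\subseteq M_{III}$ is a $\phi$-invariant Borel set that admits a Borel function $u:A\to\mathbb R$ with $\beta F=u\circ\phi-u$ on $A$; such a set exists and is unique up to $m$-null sets. Put $M_{II_\infty}=X\setminus(M_I\cup M_{II_1}\cup M_{III})$. For $t\in\{I_p, I_\infty, II_1, II_\infty, III\}$ the measure $m$ is of type $t$ if $m(M_t)=1$. Two measures are equivalent if they have the same null sets, and a measure is atomic if it is concentrated on a countable set. Theorem. Let $m$ be an ergodic $e^{\beta F}$-conformal measure. - For every $p\ge 1$: $m$ is of type $I_p$ if and only if $m$ is atomic and concentrated on an $F$-cyclic $\phi$-orbit with minimal period $p$. - $m$ is of type $I_\infty$ if and only if $m$ is atomic and concentrated on a single infinite $\phi$-orbit. - Assume, in case $\beta=0$, that $m$ is not concentrated on a finite $\phi$-orbit that is not $F$-cyclic. Then $m$ is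 of type $II_1$ if and only if $m$ is equivalent to a $\phi$-invariant non-atomic Borel probability measure. - $m$ is of type $II_\infty$ if and only if $m$ is equivalent to an infinite $\sigma$-finite non-atomic $\phi$-invariant Borel measure. - $m$ is of type $III$ if and only if $m$ is singular with respect to every $\sigma$-finite $\phi$-invariant Borel measure. -/

import Mathlib

open MeasureTheory Filter
open scoped ENNReal

namespace ConformalType

variable {X : Type*}

/-- The two-sided Birkhoff sums `S_k(F)`, `k ∈ ℤ`: for `k ≥ 0` this is
`∑_{j=0}^{k-1} F ∘ φ^j`, and for `k ≤ -1` it is `-∑_{j=1}^{|k|} F ∘ φ^{-j}`. -/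
def S (φ : X ≃ X) (F : X → ℝ) : ℤ → X → ℝ
  | Int.ofNat n => fun x => ∑ j ∈ Finset.range n, F (φ^[j] x)
  | Int.negSucc n => fun x => -∑ j ∈ Finset.Icc 1 (n + 1), F (φ.symm^[j] x)

/-- The full orbit `{φ^k(x) : k ∈ ℤ}`. -/
def orbit (φ : X ≃ X) (x : X) : Set X :=
  Set.range fun k : ℤ => ((φ : Equiv.Perm X) ^ k) x

/-- `x` is a periodic point and its orbit is `F`-cyclic: the sum of `F` over the (finite) orbit,
taken over the minimal period, is zero. -/
def IsFCyclic (φ : X ≃ X) (F : X → ℝ) (x : X) : Prop :=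
  x ∈ Function.periodicPts φ ∧
    ∑ i ∈ Finset.Icc 1 (Function.minimalPeriod φ x), F (φ^[i] x) = 0

/-- `M_{I_p}`, for `p ≥ 1`. -/
def MIp (φ : X ≃ X) (F : X → ℝ) (p : ℕ) : Set X :=
  {x | φ^[p] x = x ∧ (∀ j : ℕ, 1 ≤ j → j < p → φ^[j] x ≠ x) ∧ S φ F p x = 0}

/-- `M_{I_∞}`. All terms of the series are positive. -/
def MIinf (φ : X ≃ X) (F : X → ℝ) (β : ℝ) : Set X :=
  {x | Summable fun n : ℤ => Real.exp (β * S φ F n x)}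

/-- `M_I = M_{I_∞} ∪ ⋃_{p ≥ 1} M_{I_p}`. -/
def MI (φ : X ≃ X) (F : X → ℝ) (β : ℝ) : Set X :=
  MIinf φ F β ∪ ⋃ p ∈ Set.Ici (1 : ℕ), MIp φ F p

/-- `M_{II_1}`. The lower limit of the positive averages is taken in `[0, ∞]`, since it may
be infinite. -/
def MII1 (φ : X ≃ X) (F : X → ℝ) (β : ℝ) : Set X :=
  {x | 0 < liminf (fun n : ℕ =>
      ENNReal.ofReal ((1 / (n : ℝ)) * ∑ j ∈ Finset.Icc 1 n, Real.exp (β * S φ F (j : ℤ) x)))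
      atTop} \ MI φ F β

variable [MeasurableSpace X]

/-- `m` is an `e^{βF}`-conformal measure: a probability measure with
`m(φ(B)) = ∫_B e^{βF} dm` for all measurable `B`. -/
structure IsConformal (φ : X ≃ X) (F : X → ℝ) (β : ℝ) (m : Measure X) : Prop where
  prob : IsProbabilityMeasure m
  map_image : ∀ B : Set X, MeasurableSet B →
    m (φ '' B) = ∫⁻ x in B, ENNReal.ofReal (Real.exp (β * F x)) ∂m

/-- `M` is a possible choice of the set `M_{III}` for `m`; such a set is unique up to
`m`-null sets. Borel functions on an invariant Borel set are written as Borel functions on the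
whole space of which only the values on that set matter. -/
structure IsMIII (φ : X ≃ X) (F : X → ℝ) (β : ℝ) (m : Measure X) (M : Set X) : Prop where
  measurableSet : MeasurableSet M
  invariant : φ ⁻¹' M = M
  exists_off : ∃ u : X → ℝ, Measurable u ∧ ∀ x ∈ Mᶜ, β * F x = u (φ x) - u x
  null_of_sub : ∀ A : Set X, A ⊆ M → MeasurableSet A → φ ⁻¹' A = A →
    (∃ u : X → ℝ, Measurable u ∧ ∀ x ∈ A, β * F x = u (φ x) - u x) → m A = 0

/-- `m` is of type `I_p`. -/
def IsTypeIp (φ : X ≃ X) (F : X → ℝ) (m : Measure X) (p : ℕ) : Prop :=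
  m (MIp φ F p) = 1

/-- `m` is of type `I_∞`. -/
def IsTypeIinf (φ : X ≃ X) (F : X → ℝ) (β : ℝ) (m : Measure X) : Prop :=
  m (MIinf φ F β) = 1

/-- `m` is of type `II_1`. -/
def IsTypeII1 (φ : X ≃ X) (F : X → ℝ) (β : ℝ) (m : Measure X) : Prop :=
  m (MII1 φ F β) = 1

/-- `m` is of type `II_∞`: it is concentrated on
`M_{II_∞} = X \ (M_I ∪ M_{II_1} ∪ M_{III})`. -/
def IsTypeIIinf (φ : X ≃ X) (F : X → ℝ) (β : ℝ) (m : Measure X) : Prop :=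
  ∃ M : Set X, IsMIII φ F β m M ∧ m (MI φ F β ∪ MII1 φ F β ∪ M)ᶜ = 1

/-- `m` is of type `III`. -/
def IsTypeIII (φ : X ≃ X) (F : X → ℝ) (β : ℝ) (m : Measure X) : Prop :=
  ∃ M : Set X, IsMIII φ F β m M ∧ m M = 1

/-- `m` is (purely) atomic: it is concentrated on a countable set. -/
def IsAtomic (m : Measure X) : Prop :=
  ∃ C : Set X, C.Countable ∧ m Cᶜ = 0

/-- Equivalence of measures: the same null sets. -/
def Equivalent (m ν : Measure X) : Prop :=
  m ≪ ν ∧ ν ≪ m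

end ConformalType

/-! Conformality says that $m$ is quasi-invariant with nowhere vanishing derivative $e^{\beta F}$.
Hence $g\,m$ is invariant exactly when $e^{\beta F}\,g\circ\phi=g$ almost everywhere. Writing
$g=e^{-u}$, the equivalent σ-finite invariant measures correspond to the solutions of $\beta
F=u\circ\phi-u$ a.e. By ergodicity a solution exists on a conull invariant set or on no invariant
set of positive measure, which decides type III. It is unique up to a constant
(`coboundary_unique`), so whether the invariant measure is finite depends on $m$ alone.

Finiteness is detected by the lower density $D=\liminf\frac1n\sum_{j\le n}e^{\beta S_j(F)}$. Fatou
gives $\int D\,dm\le1$. Pointwise $D\le e^{\beta F}D\circ\phi$, and both sides have the same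
integral, so they agree a.e.; if $D>0$, then $D\,m$ is a finite invariant measure. Conversely, let
$e^{-u}m$ be finite. Then $e^{\beta S_j}=e^{u\circ\phi^j-u}$ is bounded below at the times when the
orbit avoids $\{e^{-u}>K\}$, and the maximal ergodic theorem yields orbits spending at most half of
their time in that set (`lowerDensity_pos_of_coboundary`).

For types I, a Borel set meeting each orbit of $M_{I_\infty}$ or $M_{I_p}$ in one point contains an
atom if it is not null, by ergodicity, and $m$ then lives on the orbit of that atom. Conversely, the
masses $e^{\beta S_k(F)(x)}m\{x\}$ along an atomic orbit decide where the orbit lies. -/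

namespace ConformalType

/-! ### Birkhoff cocycle, orbits and saturations -/

section Cocycle

variable {X : Type*} (T : Equiv.Perm X) (F : X → ℝ)

@[simp] lemma S_zero (x : X) : S T F 0 x = 0 := by
  change ∑ j ∈ Finset.range 0, F (T^[j] x) = 0
  simp

lemma S_natCast (n : ℕ) (x : X) : S T F n x = ∑ j ∈ Finset.range n, F (T^[j] x) := rfl

lemma S_add_one (k : ℤ) (x : X) : S T F (k + 1) x = S T F k x + F ((T ^ k) x) := by
  rcases k with n | n
  · change ∑ j ∈ Finset.range (n + 1), F (T^[j] x) = ∑ j ∈ Finset.range n, F (T^[j] x) + _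
    rw [Finset.sum_range_succ]
    simp [Equiv.Perm.iterate_eq_pow]
  · have key : F (T.symm^[n + 1] x) = F ((T ^ Int.negSucc n) x) := by
      rw [zpow_negSucc, ← inv_pow, Equiv.Perm.iterate_eq_pow]
      rfl
    rcases n with _ | n
    · change (∑ j ∈ Finset.range 0, F (T^[j] x)) = -∑ j ∈ Finset.Icc 1 1, F (T.symm^[j] x) + _
      rw [← key]
      simp
    · change -∑ j ∈ Finset.Icc 1 (n + 1), F (T.symm^[j] x)
        = -∑ j ∈ Finset.Icc 1 (n + 1 + 1), F (T.symm^[j] x) + _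
      rw [← key, Finset.sum_Icc_succ_top (Nat.le_add_left 1 (n + 1))]
      ring

lemma S_one (x : X) : S T F 1 x = F x := by
  simpa using S_add_one T F 0 x

/-- The cocycle identity for the Birkhoff sums. -/
lemma S_add (n k : ℤ) (x : X) : S T F (n + k) x = S T F k x + S T F n ((T ^ k) x) := by
  induction n using Int.induction_on with
  | zero => simp
  | succ n ih =>
    rw [show (n : ℤ) + 1 + k = n + k + 1 by ring, S_add_one, ih, S_add_one, zpow_add]
    simp [add_assoc]
  | pred n ih =>
    have h1 := S_add_one T F (-(n : ℤ) - 1 + k) x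
    have h2 := S_add_one T F (-(n : ℤ) - 1) ((T ^ k) x)
    rw [show -(n : ℤ) - 1 + k + 1 = -n + k by ring, zpow_add] at h1
    rw [show -(n : ℤ) - 1 + 1 = -n by ring] at h2
    simp only [Equiv.Perm.mul_apply] at h1
    linarith

lemma measurable_S [MeasurableSpace X] (φ : X ≃ᵐ X) {F : X → ℝ} (hF : Measurable F) (k : ℤ) :
    Measurable (S φ.toEquiv F k) := by
  rcases k with n | n
  · exact Finset.measurable_sum _ fun j _ => hF.comp (φ.measurable.iterate j)
  · exact (Finset.measurable_sum _ fun j _ => hF.comp (φ.symm.measurable.iterate j)).neg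

lemma mem_orbit_self (x : X) : x ∈ orbit T x := ⟨0, by simp⟩

lemma countable_orbit (x : X) : (orbit T x).Countable := Set.countable_range _

lemma preimage_orbit (x : X) : T ⁻¹' orbit T x = orbit T x := by
  ext y
  constructor
  · rintro ⟨k, hk⟩
    refine ⟨-1 + k, ?_⟩
    change (T ^ k) x = T y at hk
    simp [zpow_add, hk]
  · rintro ⟨k, rfl⟩
    exact ⟨1 + k, by simp [zpow_add]⟩

/-- The invariant set generated by `W`. -/
def saturation (W : Set X) : Set X := ⋃ k : ℤ, ⇑(T ^ k) ⁻¹' W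

variable {T} in
lemma mem_saturation {W : Set X} {x : X} : x ∈ saturation T W ↔ ∃ k : ℤ, (T ^ k) x ∈ W := by
  simp [saturation]

lemma subset_saturation (W : Set X) : W ⊆ saturation T W :=
  fun _ hx => mem_saturation.2 ⟨0, by simpa using hx⟩

lemma preimage_saturation (W : Set X) : T ⁻¹' saturation T W = saturation T W := by
  ext y
  simp only [Set.mem_preimage, mem_saturation]
  constructor
  · rintro ⟨k, hk⟩
    exact ⟨k + 1, by simpa [zpow_add] using hk⟩
  · rintro ⟨k, hk⟩
    exact ⟨k - 1, by simpa [zpow_sub] using hk⟩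

variable {T} in
lemma zpow_injective_of_notMem_periodicPts {x : X} (hx : x ∉ Function.periodicPts T) :
    Function.Injective fun k : ℤ => (T ^ k) x := by
  intro a b hab
  by_contra hne
  refine hx ?_
  wlog hlt : a < b generalizing a b
  · exact this hab.symm (Ne.symm hne) (lt_of_le_of_ne (not_lt.1 hlt) (Ne.symm hne))
  refine ⟨(b - a).toNat, by omega, ?_⟩
  change T^[_] x = x
  change (T ^ a) x = (T ^ b) x at hab
  rw [Equiv.Perm.iterate_eq_pow, ← zpow_natCast, Int.toNat_of_nonneg (by omega), sub_eq_neg_add,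
    zpow_add, Equiv.Perm.mul_apply, ← hab, zpow_neg]
  simp

variable {T} in
lemma orbit_finite_iff {x : X} : (orbit T x).Finite ↔ x ∈ Function.periodicPts T := by
  constructor
  · intro h
    by_contra hx
    exact Set.infinite_range_of_injective (zpow_injective_of_notMem_periodicPts hx) h
  · rintro ⟨p, hp, hpx⟩
    have h1 : (T ^ p) x = x := by rw [← Equiv.Perm.iterate_eq_pow]; exact hpx
    refine ((Set.finite_Ico (0 : ℤ) p).image fun k => (T ^ k) x).subset ?_
    rintro _ ⟨k, rfl⟩
    refine ⟨k % p, ⟨Int.emod_nonneg _ (by omega), Int.emod_lt_of_pos _ (by omega)⟩, ?_⟩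
    have h2 : (T ^ ((p : ℤ) * (k / p))) x = x := by
      rw [zpow_mul, zpow_natCast]
      exact Function.IsFixedPt.perm_zpow h1 _
    conv_rhs => rw [← Int.emod_add_mul_ediv k p]
    simp [zpow_add, h2]

end Cocycle

/-! ### Null sets, ergodicity and atoms for quasi-invariant measures -/

section QuasiInvariant

variable {X : Type*} [MeasurableSpace X] {φ : X ≃ᵐ X} {m : Measure X}

lemma measurable_perm_zpow (φ : X ≃ᵐ X) (k : ℤ) :
    Measurable ⇑((φ.toEquiv : Equiv.Perm X) ^ k) := by
  induction k using Int.induction_on with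
  | zero => exact measurable_id
  | succ n ih => rw [zpow_add_one]; exact ih.comp φ.measurable
  | pred n ih => rw [zpow_sub_one]; exact ih.comp φ.symm.measurable

lemma quasiMeasurePreserving_zpow (h : Measure.QuasiMeasurePreserving φ m m)
    (h' : Measure.QuasiMeasurePreserving φ.symm m m) (k : ℤ) :
    Measure.QuasiMeasurePreserving ⇑((φ.toEquiv : Equiv.Perm X) ^ k) m m := by
  induction k using Int.induction_on with
  | zero => exact .id m
  | succ n ih => rw [zpow_add_one]; exact ih.comp h
  | pred n ih => rw [zpow_sub_one]; exact ih.comp h'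

lemma measurableSet_saturation (φ : X ≃ᵐ X) {W : Set X} (hW : MeasurableSet W) :
    MeasurableSet (saturation φ.toEquiv W) :=
  .iUnion fun k => measurable_perm_zpow φ k hW

lemma measure_saturation_eq_zero (h : Measure.QuasiMeasurePreserving φ m m)
    (h' : Measure.QuasiMeasurePreserving φ.symm m m) {W : Set X} (hW : m W = 0) :
    m (saturation φ.toEquiv W) = 0 :=
  measure_iUnion_null fun k => (quasiMeasurePreserving_zpow h h' k).preimage_null hW

/-- A conull set contains an invariant conull set. -/
lemma exists_invariant_subset (h : Measure.QuasiMeasurePreserving φ m m)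
    (h' : Measure.QuasiMeasurePreserving φ.symm m m) {G : Set X} (hG : MeasurableSet G)
    (hG0 : m Gᶜ = 0) :
    ∃ A ⊆ G, MeasurableSet A ∧ φ ⁻¹' A = A ∧ m Aᶜ = 0 := by
  refine ⟨(saturation φ.toEquiv Gᶜ)ᶜ, ?_, (measurableSet_saturation φ hG.compl).compl, ?_, ?_⟩
  · exact Set.compl_subset_comm.1 (subset_saturation φ.toEquiv Gᶜ)
  · rw [Set.preimage_compl]
    exact congrArg _ (preimage_saturation φ.toEquiv Gᶜ)
  · rw [compl_compl]
    exact measure_saturation_eq_zero h h' hG0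

/-- A measurable set which meets every orbit at most once and has positive measure for an
ergodic measure contains an atom. -/
lemma exists_measure_singleton_ne_zero [MeasurableSpace.CountablySeparated X]
    (herg : PreErgodic φ m) {W : Set X}
    (hW : MeasurableSet W) (hW0 : m W ≠ 0)
    (htr : ∀ x ∈ W, ∀ k : ℤ, ((φ.toEquiv : Equiv.Perm X) ^ k) x ∈ W →
      ((φ.toEquiv : Equiv.Perm X) ^ k) x = x) :
    ∃ x ∈ W, m {x} ≠ 0 := by
  have hne : (W : Set X).Nonempty := by
    rw [Set.nonempty_iff_ne_empty]; rintro rfl; simp at hW0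
  have : Nonempty X := hne.to_type
  obtain ⟨c, hc⟩ : ∃ c, (id : X → X) =ᵐ[m.restrict W] Function.const X c := by
    -- It suffices that each measurable `U` is null or conull in `W`. The saturation of `U ∩ W` is
    -- null or conull. In the conull case almost every point of `W` has an iterate in `U ∩ W`, and
    -- by `htr` this iterate is the point itself.
    refine exists_eventuallyEq_const_of_forall_separating MeasurableSet fun U hU => ?_
    simp only [id]
    have hUW := hU.inter hW
    rcases herg.measure_self_or_compl_eq_zero (measurableSet_saturation φ hUW)
      (preimage_saturation φ.toEquiv _) with h0 | h0
    · right
      rw [ae_restrict_iff' hW, ae_iff]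
      refine measure_mono_null ?_ h0
      intro x hx
      simp only [Set.mem_ofPred_eq, Classical.not_imp, not_not] at hx
      exact subset_saturation _ _ ⟨hx.2, hx.1⟩
    · left
      rw [ae_restrict_iff' hW, ae_iff]
      refine measure_mono_null ?_ h0
      intro x hx hs
      simp only [Set.mem_ofPred_eq, Classical.not_imp] at hx
      obtain ⟨k, hk⟩ := mem_saturation.1 hs
      have := htr x hx.1 k hk.2
      exact hx.2 (this ▸ hk.1)
  have h0 : m (W \ {c}) = 0 := by
    rw [Filter.EventuallyEq, ae_restrict_iff' hW, ae_iff] at hc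
    refine measure_mono_null ?_ hc
    intro x hx
    simpa using hx
  have hcW : c ∈ W := by
    by_contra hcn
    rw [Set.sdiff_singleton_eq_self hcn] at h0
    exact hW0 h0
  refine ⟨c, hcW, fun hc0 => hW0 ?_⟩
  exact measure_mono_null (Set.subset_sdiff_union W {c}) (measure_union_null h0 hc0)

lemma measure_orbit_eq_one [MeasurableSingletonClass X] [IsProbabilityMeasure m]
    (herg : PreErgodic φ m) {x : X} (hx : m {x} ≠ 0) : m (orbit φ.toEquiv x) = 1 :=
  (herg.prob_eq_zero_or_one (countable_orbit _ x).measurableSet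
    (preimage_orbit φ.toEquiv x)).resolve_left fun h =>
      hx (measure_mono_null (Set.singleton_subset_iff.2 (mem_orbit_self _ x)) h)

/-- A nonzero invariant measure that is absolutely continuous with respect to an ergodic measure
is equivalent to it. -/
lemma absolutelyContinuous_of_invariant
    (herg : PreErgodic φ m) {ν : Measure X} (hν : MeasurePreserving φ ν ν) (hac : ν ≪ m)
    (hν0 : ν ≠ 0) : m ≪ ν := by
  refine Measure.AbsolutelyContinuous.mk fun B hB hB0 => ?_
  have hs : ν (saturation φ.toEquiv B) = 0 :=
    measure_saturation_eq_zero hν.quasiMeasurePreserving hν.symm.quasiMeasurePreserving hB0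
  rcases herg.measure_self_or_compl_eq_zero (measurableSet_saturation φ hB)
      (preimage_saturation φ.toEquiv _) with h0 | h0
  · exact measure_mono_null (subset_saturation _ _) h0
  · refine absurd ?_ hν0
    rw [← Measure.measure_univ_eq_zero, ← Set.union_compl_self (saturation φ.toEquiv B)]
    exact measure_union_null hs (hac h0)

end QuasiInvariant

/-! ### Maximal ergodic theorem -/

/-- The maximum of `0` and the Birkhoff sums of `g` of length at most `N`. -/
noncomputable def maxBirkhoffSum {X : Type*} (T : X → X) (g : X → ℝ) : ℕ → X → ℝ
  | 0 => fun _ => 0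
  | N + 1 => fun x => max 0 (g x + maxBirkhoffSum T g N (T x))

/-- The maximal ergodic theorem, for the positive part `M` of the maximal Birkhoff sum. -/
theorem exists_maximal_ergodic {X : Type*} [MeasurableSpace X] {ν : Measure X}
    {T : X → X} (hT : MeasurePreserving T ν ν) {g : X → ℝ} (hg : Measurable g)
    (hgi : Integrable g ν) (N : ℕ) :
    ∃ M : X → ℝ, Measurable M ∧ (∀ n ≤ N, ∀ x, birkhoffSum T g n x ≤ M x) ∧
      0 ≤ ∫ x in {x | 0 < M x}, g x ∂ν := by
  set M := maxBirkhoffSum T g with hM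
  have M0 : ∀ x, M 0 x = 0 := fun _ => rfl
  have Ms : ∀ n x, M (n + 1) x = max 0 (g x + M n (T x)) := fun _ _ => rfl
  have hnn : ∀ n x, 0 ≤ M n x := by
    intro n x
    cases n with
    | zero => simp [M0]
    | succ n => simp [Ms]
  have hmono : ∀ n x, M n x ≤ M (n + 1) x := by
    intro n
    induction n with
    | zero => intro x; rw [M0]; exact hnn 1 x
    | succ n ih =>
      intro x
      rw [Ms n, Ms (n + 1)]
      exact max_le_max le_rfl (by linarith [ih (T x)])
  have hmeas : ∀ n, Measurable (M n) := by
    intro n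
    induction n with
    | zero => exact measurable_const
    | succ n ih => exact measurable_const.max (hg.add (ih.comp hT.measurable))
  have hint : ∀ n, Integrable (M n) ν := by
    intro n
    induction n with
    | zero => exact integrable_zero _ _ _
    | succ n ih =>
      exact (integrable_zero X ℝ ν).sup (hgi.add (hT.integrable_comp_of_integrable ih))
  have hbs : ∀ n x, birkhoffSum T g n x ≤ M n x := by
    intro n
    induction n with
    | zero => intro x; simp [M0]
    | succ n ih =>
      intro x
      rw [birkhoffSum_succ', Ms]
      exact le_max_of_le_right (by linarith [ih (T x)])
  have hmn : ∀ x, Monotone fun n => M n x := fun x => monotone_nat_of_le_succ fun n => hmono n x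
  -- The index `N + 1` lets the recursion be unfolded on `E` even when `N = 0`.
  refine ⟨M (N + 1), hmeas (N + 1),
    fun n hn x => (hbs n x).trans (hmn x (hn.trans (Nat.le_succ N))), ?_⟩
  set E := {x | 0 < M (N + 1) x}
  have hE : MeasurableSet E := measurableSet_lt measurable_const (hmeas _)
  have hcomp : Integrable (fun x => M (N + 1) (T x)) ν := hT.integrable_comp_of_integrable (hint (N + 1))
  have h1 : ∫ x in E, M (N + 1) x ∂ν = ∫ x, M (N + 1) x ∂ν := by
    refine setIntegral_eq_integral_of_forall_compl_eq_zero fun x hx => ?_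
    exact le_antisymm (not_lt.1 hx) (hnn _ _)
  have h2 : ∫ x in E, M (N + 1) (T x) ∂ν ≤ ∫ x, M (N + 1) (T x) ∂ν :=
    setIntegral_le_integral hcomp (ae_of_all _ fun x => hnn _ _)
  have h3 : ∫ x, M (N + 1) (T x) ∂ν = ∫ x, M (N + 1) x ∂ν := by
    conv_rhs => rw [← hT.map_eq]
    rw [integral_map hT.measurable.aemeasurable (hmeas _).aestronglyMeasurable]
  -- On `E` the maximum in the recursion is its second entry, so `M (N + 1) x = g x + M N (T x) ≤ g
  -- x + M (N + 1) (T x)`. By invariance the left-hand integral is nonnegative.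
  have h4 : ∫ x in E, (M (N + 1) x - M (N + 1) (T x)) ∂ν ≤ ∫ x in E, g x ∂ν := by
    refine setIntegral_mono_on ((hint _).sub hcomp).integrableOn hgi.integrableOn hE fun x hx => ?_
    have hx' : 0 < M (N + 1) x := hx
    have := hmono N (T x)
    rw [Ms] at hx' ⊢
    rcases lt_max_iff.1 hx' with h | h
    · exact absurd h (lt_irrefl _)
    · rw [max_eq_right h.le]
      linarith
  rw [integral_sub (hint _).integrableOn hcomp.integrableOn] at h4
  linarith

/-- For a measure preserving map, the set of points for which the frequency of visits to `B`
exceeds `1/2` at some time has measure at most `2 ν(B)`. -/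
theorem measure_exists_birkhoffSum_pos_le {X : Type*} [MeasurableSpace X] {ν : Measure X}
    [IsFiniteMeasure ν] {T : X → X} (hT : MeasurePreserving T ν ν) {B : Set X}
    (hB : MeasurableSet B) :
    ν {x | ∃ n, 0 < birkhoffSum T (fun x => B.indicator 1 x - 1 / 2 : X → ℝ) n x} ≤ 2 * ν B := by
  set g : X → ℝ := fun x => B.indicator 1 x - 1 / 2
  have hg : Measurable g := (measurable_one.indicator hB).sub_const _
  have hgi : Integrable g ν := ((integrable_const 1).indicator hB).sub (integrable_const _)
  have hmono : Monotone fun N : ℕ => {x | ∃ n ≤ N, 0 < birkhoffSum T g n x} :=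
    fun a b hab x ⟨n, hn, h⟩ => ⟨n, hn.trans hab, h⟩
  have : {x | ∃ n, 0 < birkhoffSum T g n x}
      = ⋃ N : ℕ, {x | ∃ n ≤ N, 0 < birkhoffSum T g n x} := by
    ext x
    simp only [Set.mem_ofPred_eq, Set.mem_iUnion]
    exact ⟨fun ⟨n, h⟩ => ⟨n, n, le_rfl, h⟩, fun ⟨_, n, _, h⟩ => ⟨n, h⟩⟩
  rw [this, hmono.measure_iUnion]
  refine iSup_le fun N => ?_
  obtain ⟨M, hM, hle, hpos⟩ := exists_maximal_ergodic hT hg hgi N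
  have hE : MeasurableSet {x | 0 < M x} := measurableSet_lt measurable_const hM
  refine (measure_mono (t := {x | 0 < M x}) ?_).trans ?_
  · rintro x ⟨n, hn, h⟩
    exact h.trans_le (hle n hn x)
  · have h1 : ∫ x in {x | 0 < M x}, g x ∂ν
        = ν.real (B ∩ {x | 0 < M x}) - ν.real {x | 0 < M x} * (1 / 2) := by
      have hi : Integrable (B.indicator (1 : X → ℝ)) ν := (integrable_const (1 : ℝ)).indicator hB
      have hc : Integrable (fun _ : X => (1 / 2 : ℝ)) ν := integrable_const _
      rw [integral_sub hi.integrableOn hc.integrableOn, integral_indicator_one hB, measureReal_restrict_apply hB]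
      simp
    have h2 : ν.real (B ∩ {x | 0 < M x}) ≤ ν.real B := measureReal_mono Set.inter_subset_left
    have h3 : ν.real {x | 0 < M x} ≤ 2 * ν.real B := by linarith
    rw [← ofReal_measureReal (μ := ν) (s := B), ← ofReal_measureReal (μ := ν) (s := {x | 0 < M x})]
    rw [show (2 : ℝ≥0∞) = ENNReal.ofReal 2 by simp, ← ENNReal.ofReal_mul (by norm_num)]
    exact ENNReal.ofReal_le_ofReal h3

/-! ### Periodicity and summability along single orbits -/

section Orbits

variable {X : Type*} {T : Equiv.Perm X} {F : X → ℝ} {β : ℝ}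

lemma S_zpow (n k : ℤ) (x : X) : S T F n ((T ^ k) x) = S T F (n + k) x - S T F k x := by
  rw [S_add]; ring

lemma zpow_mem_MIinf {x : X} (hx : x ∈ MIinf T F β) (k : ℤ) : (T ^ k) x ∈ MIinf T F β := by
  have h1 : Summable fun n : ℤ => Real.exp (β * S T F n x) := hx
  have h2 := ((Equiv.addRight k).summable_iff.2 h1).mul_right (Real.exp (-(β * S T F k x)))
  refine h2.congr fun n => ?_
  simp only [Function.comp, Equiv.coe_addRight]
  rw [S_zpow, ← Real.exp_add]
  congr 1
  ring

lemma zpow_apply_period {x : X} {p : ℕ} (h : T^[p] x = x) : (T ^ (p : ℤ)) x = x := by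
  rw [zpow_natCast, ← Equiv.Perm.iterate_eq_pow, h]

/-- At multiples of a period the values $S_{pn}$ and $S_{-pn}$ are opposite, so the two exponentials
multiply to 1, while summability sends both to 0. -/
lemma notMem_periodicPts_of_mem_MIinf {x : X} (hx : x ∈ MIinf T F β) :
    x ∉ Function.periodicPts T := by
  rintro ⟨p, hp, hpx⟩
  have hpx' : (T ^ (p : ℤ)) x = x := zpow_apply_period hpx
  have hpn (n : ℤ) : (T ^ ((p : ℤ) * n)) x = x := by
    rw [zpow_mul]
    exact Function.IsFixedPt.perm_zpow hpx' n
  have h1 : Tendsto (fun n : ℤ => Real.exp (β * S T F n x)) cofinite (nhds 0) :=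
    Summable.tendsto_cofinite_zero hx
  have hp0 : (p : ℤ) ≠ 0 := by exact_mod_cast hp.ne'
  have i1 : Function.Injective fun n : ℤ => (p : ℤ) * n := mul_right_injective₀ hp0
  have i2 : Function.Injective fun n : ℤ => -((p : ℤ) * n) := neg_injective.comp i1
  have h2 := (h1.comp i1.tendsto_cofinite).mul (h1.comp i2.tendsto_cofinite)
  have h3 : (fun n : ℤ => Real.exp (β * S T F (p * n) x) * Real.exp (β * S T F (-(p * n)) x))
      = fun _ => 1 := by
    ext n
    have := S_add T F (-((p : ℤ) * n)) (p * n) x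
    rw [hpn, neg_add_cancel, S_zero] at this
    rw [← Real.exp_add, ← mul_add, ← this, mul_zero, Real.exp_zero]
  simp only [Function.comp_def, mul_zero] at h2
  rw [h3] at h2
  exact one_ne_zero (tendsto_nhds_unique tendsto_const_nhds h2)

lemma sum_Icc_one {M : Type*} [AddCommMonoid M] (f : ℕ → M) (n : ℕ) :
    ∑ i ∈ Finset.Icc 1 n, f i = ∑ i ∈ Finset.range n, f (i + 1) := by
  have : Finset.Icc 1 n = Finset.Ico 1 (n + 1) := by ext; simp
  rw [this, Finset.sum_Ico_eq_sum_range]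
  simp [add_comm]

lemma sum_Icc_eq_S {x : X} {p : ℕ} (h : T^[p] x = x) :
    ∑ i ∈ Finset.Icc 1 p, F (T^[i] x) = S T F p x := by
  have h1 := Finset.sum_range_succ (fun i => F (T^[i] x)) p
  have h2 := Finset.sum_range_succ' (fun i => F (T^[i] x)) p
  rw [h] at h1
  rw [h1, Function.iterate_zero_apply, add_left_inj] at h2
  rw [S_natCast, h2, sum_Icc_one]

lemma mem_MIp_iff {x : X} {p : ℕ} (hp : 1 ≤ p) :
    x ∈ MIp T F p ↔ IsFCyclic T F x ∧ Function.minimalPeriod T x = p := by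
  constructor
  · rintro ⟨h1, h2, h3⟩
    have hper : Function.IsPeriodicPt T p x := h1
    have hmin : Function.minimalPeriod T x = p := by
      refine le_antisymm (hper.minimalPeriod_le hp) (not_lt.1 fun hlt => ?_)
      exact h2 _ (hper.minimalPeriod_pos hp) hlt (Function.iterate_minimalPeriod)
    refine ⟨⟨⟨p, hp, hper⟩, ?_⟩, hmin⟩
    rw [hmin, sum_Icc_eq_S h1, h3]
  · rintro ⟨⟨h1, h2⟩, rfl⟩
    refine ⟨Function.iterate_minimalPeriod, fun j hj hlt hjx => ?_, ?_⟩
    · exact absurd (Function.IsPeriodicPt.minimalPeriod_le (f := T) hj hjx) (not_le.2 hlt)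
    · rw [← sum_Icc_eq_S Function.iterate_minimalPeriod, h2]

lemma zpow_mem_MIp {x : X} {p : ℕ} (hx : x ∈ MIp T F p) (k : ℤ) : (T ^ k) x ∈ MIp T F p := by
  obtain ⟨h1, h2, h3⟩ := hx
  have hit (j : ℕ) : T^[j] ((T ^ k) x) = (T ^ k) (T^[j] x) := by
    simp only [Equiv.Perm.iterate_eq_pow, ← Equiv.Perm.mul_apply, ← zpow_natCast, ← zpow_add,
      add_comm]
  refine ⟨by rw [hit, h1], fun j hj hlt hjx => h2 j hj hlt ?_, ?_⟩
  · rw [hit] at hjx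
    exact (T ^ k).injective hjx
  · rw [S_zpow, add_comm, S_add, zpow_apply_period h1, h3]
    ring

/-- In the orbit of a point of `M_{I_∞}` the first point at which the cocycle is maximal. -/
lemma exists_zpow_first_max {x : X} (hx : x ∈ MIinf T F β) :
    ∃ k : ℤ, (∀ n, β * S T F n ((T ^ k) x) ≤ 0) ∧ ∀ n < 0, β * S T F n ((T ^ k) x) < 0 := by
  have h1 : Tendsto (fun n : ℤ => Real.exp (β * S T F n x)) cofinite (nhds 0) :=
    Summable.tendsto_cofinite_zero hx
  have hfin : {n : ℤ | 0 ≤ β * S T F n x}.Finite := by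
    have := h1.eventually (gt_mem_nhds zero_lt_one)
    rw [eventually_cofinite] at this
    refine this.subset fun n hn => ?_
    simpa using hn
  obtain ⟨a, ha, hamax⟩ := Set.exists_max_image _ (fun n => β * S T F n x) hfin ⟨0, by simp⟩
  have hall (n : ℤ) : β * S T F n x ≤ β * S T F a x := by
    by_cases hn : 0 ≤ β * S T F n x
    · exact hamax n hn
    · exact (not_le.1 hn).le.trans ha
  have hfin' : {n : ℤ | β * S T F n x = β * S T F a x}.Finite :=
    hfin.subset fun n hn => by
      change β * S T F n x = β * S T F a x at hn
      change 0 ≤ β * S T F n x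
      rw [hn]; exact ha
  -- Taking the least index among the finitely many maximisers breaks ties, so each orbit gets one
  -- distinguished point.
  obtain ⟨k, hk, hkmin⟩ := Set.exists_min_image _ id hfin' ⟨a, rfl⟩
  change β * S T F k x = β * S T F a x at hk
  refine ⟨k, fun n => ?_, fun n hn => ?_⟩
  · rw [S_zpow, mul_sub, hk]
    linarith [hall (n + k)]
  · rw [S_zpow, mul_sub, hk]
    refine sub_neg.2 (lt_of_le_of_ne (hall _) fun heq => ?_)
    have := hkmin (n + k) heq
    simp only [id] at this
    omega

end Orbits

section Measurable

variable {X : Type*} [MeasurableSpace X] {φ : X ≃ᵐ X} {F : X → ℝ} {β : ℝ}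

lemma measurableSet_MIinf (hF : Measurable F) : MeasurableSet (MIinf φ.toEquiv F β) := by
  have : MIinf φ.toEquiv F β
      = {x | ∑' n : ℤ, ENNReal.ofReal (Real.exp (β * S φ.toEquiv F n x)) = ∞}ᶜ := by
    ext x
    simp only [MIinf, Set.mem_ofPred_eq, Set.mem_compl_iff]
    refine ⟨fun h => h.tsum_ofReal_ne_top, fun h => ?_⟩
    refine (ENNReal.summable_toReal h).congr fun n => ?_
    exact ENNReal.toReal_ofReal (Real.exp_pos _).le
  rw [this]
  refine (measurableSet_eq_fun (Measurable.tsum fun n => ?_) measurable_const).compl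
  exact (Real.measurable_exp.comp ((measurable_S φ hF n).const_mul β)).ennreal_ofReal

lemma measurableSet_MIp [StandardBorelSpace X] (hF : Measurable F) (p : ℕ) :
    MeasurableSet (MIp φ.toEquiv F p) := by
  have h (j : ℕ) : MeasurableSet {x | φ.toEquiv^[j] x = x} := by
    have he := MeasureTheory.measurableEmbedding_embeddingReal X
    have : {x | φ.toEquiv^[j] x = x}
        = {x | embeddingReal X (φ.toEquiv^[j] x) = embeddingReal X x} := by
      ext x; exact he.injective.eq_iff.symm
    rw [this]
    exact measurableSet_eq_fun (he.measurable.comp (φ.measurable.iterate j)) he.measurable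
  have : MIp φ.toEquiv F p = {x | φ.toEquiv^[p] x = x} ∩
      ((⋂ j : ℕ, ⋂ _ : 1 ≤ j, ⋂ _ : j < p, {x | φ.toEquiv^[j] x = x}ᶜ) ∩
        {x | S φ.toEquiv F p x = 0}) := by
    ext x; simp [MIp]
  rw [this]
  refine (h p).inter (.inter ?_ (measurableSet_eq_fun (measurable_S φ hF p) measurable_const))
  exact .iInter fun j => .iInter fun _ => .iInter fun _ => (h j).compl

lemma measurableSet_MI [StandardBorelSpace X] (hF : Measurable F) :
    MeasurableSet (MI φ.toEquiv F β) :=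
  (measurableSet_MIinf hF).union (.biUnion (Set.to_countable _) fun p _ => measurableSet_MIp hF p)

end Measurable

/-! ### Quasi-invariance and atoms of conformal measures -/

namespace IsConformal

variable {X : Type*} [MeasurableSpace X] {φ : X ≃ᵐ X} {F : X → ℝ} {β : ℝ} {m : Measure X}

lemma map_symm (hm : IsConformal φ.toEquiv F β m) :
    m.map φ.symm = m.withDensity fun x => ENNReal.ofReal (Real.exp (β * F x)) := by
  ext B hB
  rw [Measure.map_apply φ.symm.measurable hB, withDensity_apply _ hB, ← hm.map_image B hB,
    Equiv.image_eq_preimage_symm]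
  rfl

lemma measurable_density (hF : Measurable F) :
    Measurable fun x => ENNReal.ofReal (Real.exp (β * F x)) :=
  (Real.measurable_exp.comp (hF.const_mul β)).ennreal_ofReal

lemma quasiMeasurePreserving_symm (hm : IsConformal φ.toEquiv F β m) :
    Measure.QuasiMeasurePreserving φ.symm m m :=
  ⟨φ.symm.measurable, by rw [hm.map_symm]; exact withDensity_absolutelyContinuous _ _⟩

lemma quasiMeasurePreserving (hm : IsConformal φ.toEquiv F β m) (hF : Measurable F) :
    Measure.QuasiMeasurePreserving φ m m := by
  refine ⟨φ.measurable, ?_⟩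
  have h1 : m ≪ m.map φ.symm := by
    rw [hm.map_symm]
    refine withDensity_absolutelyContinuous' (measurable_density hF).aemeasurable ?_
    exact ae_of_all _ fun x => (ENNReal.ofReal_pos.2 (Real.exp_pos _)).ne'
  have h2 := h1.map φ.measurable
  rwa [Measure.map_map φ.measurable φ.symm.measurable, MeasurableEquiv.self_comp_symm,
    Measure.map_id] at h2

lemma quasiErgodic (hm : IsConformal φ.toEquiv F β m) (hF : Measurable F)
    (herg : PreErgodic φ m) : QuasiErgodic φ m :=
  { hm.quasiMeasurePreserving hF, herg with }

/-- Change of variables: the operator $g\mapsto e^{\beta F}\,g\circ\phi$ preserves the integral. -/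
lemma lintegral_comp_mul (hm : IsConformal φ.toEquiv F β m) (hF : Measurable F)
    {g : X → ℝ≥0∞} (hg : Measurable g) :
    ∫⁻ x, ENNReal.ofReal (Real.exp (β * F x)) * g (φ x) ∂m = ∫⁻ x, g x ∂m := by
  have h := lintegral_withDensity_eq_lintegral_mul m (measurable_density (β := β) hF)
    (hg.comp φ.measurable)
  rw [← hm.map_symm, lintegral_map (hg.comp φ.measurable) φ.symm.measurable] at h
  simpa using h.symm

lemma measure_singleton_apply [MeasurableSingletonClass X] (hm : IsConformal φ.toEquiv F β m)
    (x : X) : m {φ x} = ENNReal.ofReal (Real.exp (β * F x)) * m {x} := by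
  have h := hm.map_image {x} (measurableSet_singleton x)
  rwa [Set.image_singleton, lintegral_singleton] at h

lemma measure_singleton_zpow [MeasurableSingletonClass X] (hm : IsConformal φ.toEquiv F β m)
    (k : ℤ) (x : X) : m {((φ.toEquiv : Equiv.Perm X) ^ k) x}
      = ENNReal.ofReal (Real.exp (β * S φ.toEquiv F k x)) * m {x} := by
  have step (k : ℤ) := hm.measure_singleton_apply (((φ.toEquiv : Equiv.Perm X) ^ k) x)
  have hs (k : ℤ) : ((φ.toEquiv : Equiv.Perm X) ^ (k + 1)) x
      = φ (((φ.toEquiv : Equiv.Perm X) ^ k) x) := by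
    rw [add_comm, zpow_add]; rfl
  induction k using Int.induction_on with
  | zero => simp
  | succ n ih =>
    rw [hs, step, ih, S_add_one, mul_add, Real.exp_add, ENNReal.ofReal_mul (Real.exp_pos _).le]
    ring
  | pred n ih =>
    have h1 := hs (-n - 1)
    have h2 := S_add_one φ.toEquiv F (-n - 1) x
    rw [sub_add_cancel] at h1 h2
    rw [h1, step, h2, mul_add, Real.exp_add, mul_comm (Real.exp _),
      ENNReal.ofReal_mul (Real.exp_pos _).le, mul_assoc] at ih
    refine (ENNReal.mul_right_inj ?_ ENNReal.ofReal_ne_top).1 ih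
    exact (ENNReal.ofReal_pos.2 (Real.exp_pos _)).ne'

/-- The points of an infinite orbit are distinct and carry masses $e^{\beta S_k(F)(x)}m\{x\}$, whose
sum is at most the finite total mass. -/
lemma mem_MIinf_of_orbit_infinite [MeasurableSingletonClass X]
    (hm : IsConformal φ.toEquiv F β m) {x : X} (hx : m {x} ≠ 0)
    (hinf : (orbit φ.toEquiv x).Infinite) : x ∈ MIinf φ.toEquiv F β := by
  have := hm.prob
  have hinj := zpow_injective_of_notMem_periodicPts (mt orbit_finite_iff.2 hinf)
  have h1 : ∑' k : ℤ, m {((φ.toEquiv : Equiv.Perm X) ^ k) x} ≠ ∞ := by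
    rw [← measure_iUnion (fun i j hij => by simpa using fun h => hij (hinj h))
      fun _ => measurableSet_singleton _]
    exact measure_ne_top _ _
  simp_rw [hm.measure_singleton_zpow] at h1
  rw [ENNReal.tsum_mul_right] at h1
  have h2 : ∑' k : ℤ, ENNReal.ofReal (Real.exp (β * S φ.toEquiv F k x)) ≠ ∞ :=
    fun h => h1 (by rw [h, ENNReal.top_mul hx])
  refine (ENNReal.summable_toReal h2).congr fun n => ?_
  exact ENNReal.toReal_ofReal (Real.exp_pos _).le

/-- Going once through the period multiplies the positive finite mass of `x` by $e^{\beta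
S_p(F)(x)}$ and returns it unchanged. -/
lemma mul_S_eq_zero [MeasurableSingletonClass X]
    (hm : IsConformal φ.toEquiv F β m) {x : X} (hx : m {x} ≠ 0) {p : ℕ}
    (hp : φ^[p] x = x) : β * S φ.toEquiv F p x = 0 := by
  have := hm.prob
  have h1 := hm.measure_singleton_zpow p x
  rw [zpow_apply_period (T := φ.toEquiv) hp] at h1
  have h2 : ENNReal.ofReal (Real.exp (β * S φ.toEquiv F p x)) = 1 := by
    rw [← ENNReal.mul_left_inj hx (measure_ne_top m {x}), ← h1, one_mul]
  rwa [ENNReal.ofReal_eq_one, Real.exp_eq_one_iff] at h2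

lemma exists_atom_of_MIinf [StandardBorelSpace X] (hm : IsConformal φ.toEquiv F β m)
    (hF : Measurable F) (herg : PreErgodic φ m) (h0 : m (MIinf φ.toEquiv F β) ≠ 0) :
    ∃ x ∈ MIinf φ.toEquiv F β, m {x} ≠ 0 := by
  set W := MIinf φ.toEquiv F β ∩ ((⋂ n : ℤ, {x | β * S φ.toEquiv F n x ≤ 0}) ∩
    ⋂ n : ℤ, ⋂ _ : n < 0, {x | β * S φ.toEquiv F n x < 0}) with hWdef
  have hS (n : ℤ) : Measurable fun x => β * S φ.toEquiv F n x := (measurable_S φ hF n).const_mul β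
  have hW : MeasurableSet W := (measurableSet_MIinf hF).inter
    (.inter (.iInter fun n => measurableSet_le (hS n) measurable_const)
      (.iInter fun n => .iInter fun _ => measurableSet_lt (hS n) measurable_const))
  have hWmem (x : X) : x ∈ W ↔ x ∈ MIinf φ.toEquiv F β ∧ (∀ n, β * S φ.toEquiv F n x ≤ 0) ∧
      ∀ n < 0, β * S φ.toEquiv F n x < 0 := by
    simp [hWdef]
  have hW0 : m W ≠ 0 := by
    refine fun h => h0 (measure_mono_null (fun x hx => ?_) (measure_saturation_eq_zero
      (hm.quasiMeasurePreserving hF) hm.quasiMeasurePreserving_symm h))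
    obtain ⟨k, hk⟩ := exists_zpow_first_max hx
    exact mem_saturation.2 ⟨k, (hWmem _).2 ⟨zpow_mem_MIinf hx k, hk⟩⟩
  -- Two first maxima on one orbit coincide: $S_{-k}(F)(T^kx)=-S_k(F)(x)$, so for $k\ne0$ one of the
  -- points violates the strict inequality at negative times.
  obtain ⟨x, hx, hx0⟩ := exists_measure_singleton_ne_zero herg hW hW0 fun x hx k hk => by
    rw [hWmem] at hx hk
    have h1 := S_zpow (T := φ.toEquiv) (F := F) (-k) k x
    rw [neg_add_cancel, S_zero, zero_sub] at h1
    rcases lt_trichotomy k 0 with h | rfl | h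
    · have h2 := hk.2.1 (-k)
      have h3 := hx.2.2 k h
      rw [h1] at h2
      linarith
    · rfl
    · have h2 := hk.2.2 (-k) (by omega)
      have h3 := hx.2.1 k
      rw [h1] at h2
      linarith
  exact ⟨x, ((hWmem x).1 hx).1, hx0⟩

/-- All points of a finite orbit look alike to the cocycle, so the transversal takes the point with
least image under a Borel embedding into ℝ. -/
lemma exists_atom_of_MIp [StandardBorelSpace X] (hm : IsConformal φ.toEquiv F β m)
    (hF : Measurable F) (herg : PreErgodic φ m) {p : ℕ} (hp : 1 ≤ p)
    (h0 : m (MIp φ.toEquiv F p) ≠ 0) :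
    ∃ x ∈ MIp φ.toEquiv F p, m {x} ≠ 0 := by
  set T : Equiv.Perm X := φ.toEquiv
  have he := measurableEmbedding_embeddingReal X
  set W := MIp T F p ∩ ⋂ n : ℤ, {x | embeddingReal X x ≤ embeddingReal X ((T ^ n) x)} with hWdef
  have hW : MeasurableSet W := (measurableSet_MIp hF p).inter
    (.iInter fun n => measurableSet_le he.measurable
      (he.measurable.comp (measurable_perm_zpow φ n)))
  have hWmem (x : X) : x ∈ W ↔ x ∈ MIp T F p ∧
      ∀ n : ℤ, embeddingReal X x ≤ embeddingReal X ((T ^ n) x) := by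
    simp [hWdef]
  have hW0 : m W ≠ 0 := by
    refine fun h => h0 (measure_mono_null (fun x hx => ?_) (measure_saturation_eq_zero
      (hm.quasiMeasurePreserving hF) hm.quasiMeasurePreserving_symm h))
    have hfin : (orbit T x).Finite := orbit_finite_iff.2 ((mem_MIp_iff hp).1 hx).1.1
    obtain ⟨_, ⟨k, rfl⟩, hk⟩ := Set.exists_min_image _ (embeddingReal X) hfin
      ⟨x, mem_orbit_self T x⟩
    refine mem_saturation.2 ⟨k, (hWmem _).2 ⟨zpow_mem_MIp hx k, fun n => hk _ ⟨n + k, ?_⟩⟩⟩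
    simp [T, zpow_add]
  obtain ⟨x, hx, hx0⟩ := exists_measure_singleton_ne_zero herg hW hW0 fun x hx k hk => by
    rw [hWmem] at hx hk
    refine he.injective (le_antisymm ?_ (hx.2 k))
    have := hk.2 (-k)
    rwa [← Equiv.Perm.mul_apply, show T ^ (-k) * φ.toEquiv ^ k = 1 by simp [T],
      Equiv.Perm.one_apply] at this
  exact ⟨x, ((hWmem x).1 hx).1, hx0⟩

lemma measure_MI_eq_zero [StandardBorelSpace X] [NullSingletonClass m]
    (hm : IsConformal φ.toEquiv F β m) (hF : Measurable F) (herg : PreErgodic φ m) :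
    m (MI φ.toEquiv F β) = 0 := by
  refine measure_union_null ?_ ((measure_biUnion_null_iff (Set.to_countable _)).2 fun p hp => ?_)
  · by_contra h
    obtain ⟨x, -, hx⟩ := hm.exists_atom_of_MIinf hF herg h
    exact hx (measure_singleton x)
  · by_contra h
    obtain ⟨x, -, hx⟩ := hm.exists_atom_of_MIp hF herg hp h
    exact hx (measure_singleton x)

end IsConformal

/-! ### Lower density of the cocycle -/

/-- The function whose positivity defines `M_{II_1}` outside of `M_I`. -/
noncomputable def lowerDensity {X : Type*} (T : X ≃ X) (F : X → ℝ) (β : ℝ) (x : X) : ℝ≥0∞ :=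
  liminf (fun n : ℕ => ENNReal.ofReal
    ((1 / (n : ℝ)) * ∑ j ∈ Finset.Icc 1 n, Real.exp (β * S T F (j : ℤ) x))) atTop

lemma MII1_eq {X : Type*} (T : X ≃ X) (F : X → ℝ) (β : ℝ) :
    MII1 T F β = {x | 0 < lowerDensity T F β x} \ MI T F β := rfl

lemma measurable_exp_S {X : Type*} [MeasurableSpace X] {φ : X ≃ᵐ X} {F : X → ℝ} (β : ℝ)
    (hF : Measurable F) (k : ℤ) : Measurable fun x => Real.exp (β * S φ.toEquiv F k x) :=
  Real.measurable_exp.comp ((measurable_S φ hF k).const_mul β)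

lemma measurable_average {X : Type*} [MeasurableSpace X] {φ : X ≃ᵐ X} {F : X → ℝ} (β : ℝ)
    (hF : Measurable F) (n : ℕ) :
    Measurable fun x => ENNReal.ofReal
      ((1 / (n : ℝ)) * ∑ j ∈ Finset.Icc 1 n, Real.exp (β * S φ.toEquiv F (j : ℤ) x)) :=
  ((Finset.measurable_sum (Finset.Icc 1 n) fun (j : ℕ) _ =>
    measurable_exp_S (φ := φ) β hF j).const_mul _).ennreal_ofReal

lemma measurable_lowerDensity {X : Type*} [MeasurableSpace X] {φ : X ≃ᵐ X} {F : X → ℝ} {β : ℝ}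
    (hF : Measurable F) : Measurable (lowerDensity φ.toEquiv F β) :=
  Measurable.liminf fun n => measurable_average β hF n

lemma measurableSet_MII1 {X : Type*} [MeasurableSpace X] [StandardBorelSpace X] {φ : X ≃ᵐ X}
    {F : X → ℝ} {β : ℝ} (hF : Measurable F) : MeasurableSet (MII1 φ.toEquiv F β) :=
  (measurableSet_lt measurable_const (measurable_lowerDensity hF)).diff (measurableSet_MI hF)

/-- For β = 0 an atom on a finite orbit that is not `F`-cyclic therefore lies in $M_{II_1}$. Type
$II_1$ has to exclude this case by hypothesis; type $II_\infty$ does not. -/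
lemma lowerDensity_zero_pos {X : Type*} (T : X ≃ X) (F : X → ℝ) (x : X) :
    0 < lowerDensity T F 0 x := by
  refine lt_of_lt_of_le zero_lt_one (le_liminf_of_le (by isBoundedDefault) ?_)
  filter_upwards [eventually_gt_atTop 0] with n hn
  have hn' : (n : ℝ) ≠ 0 := by exact_mod_cast hn.ne'
  simp [hn']

/-- Lower densities increase along the cocycle. -/
lemma lowerDensity_le {X : Type*} (T : Equiv.Perm X) (F : X → ℝ) (β : ℝ) (x : X) :
    lowerDensity T F β x
      ≤ ENNReal.ofReal (Real.exp (β * F x)) * lowerDensity T F β (T x) := by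
  have hS (j : ℕ) : S T F ((j + 1 : ℕ) : ℤ) x = F x + S T F j (T x) := by
    have := S_add T F j 1 x
    rw [S_one, zpow_one] at this
    exact_mod_cast this
  -- Shifting the sum by one step leaves over the term `j = 1`, which vanishes after division by
  -- `n`. Replacing `1 / (n + 1)` by `1 / n` costs only an inequality.
  have hz : Tendsto (fun n : ℕ => ENNReal.ofReal (1 / (n : ℝ) * Real.exp (β * F x))) atTop
      (nhds 0) := by
    rw [← ENNReal.ofReal_zero]
    refine ENNReal.tendsto_ofReal ?_
    simpa using tendsto_one_div_atTop_nhds_zero_nat.mul_const (Real.exp (β * F x))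
  rw [lowerDensity, lowerDensity, ← ENNReal.liminf_const_mul_of_ne_top ENNReal.ofReal_ne_top,
    ← liminf_nat_add _ 1, ← ENNReal.liminf_add_of_right_tendsto_zero hz
      (fun n : ℕ => ENNReal.ofReal (Real.exp (β * F x)) * _)]
  refine liminf_le_liminf ?_
  filter_upwards [eventually_ge_atTop 1] with n hn
  have hn' : (0 : ℝ) < n := by exact_mod_cast hn
  have hpos : 0 ≤ ∑ j ∈ Finset.Icc 1 n, Real.exp (β * S T F (j : ℤ) (T x)) :=
    Finset.sum_nonneg fun _ _ => (Real.exp_pos _).le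
  simp only [Pi.add_apply]
  rw [← ENNReal.ofReal_mul (Real.exp_pos _).le,
    ← ENNReal.ofReal_add (by positivity) (by positivity)]
  refine ENNReal.ofReal_le_ofReal ?_
  have hsum : ∑ j ∈ Finset.Icc 1 (n + 1), Real.exp (β * S T F (j : ℤ) x)
      = Real.exp (β * F x) * ∑ j ∈ Finset.Icc 1 n, Real.exp (β * S T F (j : ℤ) (T x))
        + Real.exp (β * F x) := by
    rw [sum_Icc_one, Finset.sum_range_succ', sum_Icc_one, Finset.mul_sum]
    congr 1
    · refine Finset.sum_congr rfl fun j _ => ?_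
      rw [hS (j + 1), mul_add, Real.exp_add]
    · simp [S_one]
  rw [hsum]
  have hle : (1 / ((n + 1 : ℕ) : ℝ)) ≤ 1 / n :=
    one_div_le_one_div_of_le hn' (by push_cast; linarith)
  calc _ ≤ 1 / (n : ℝ) * (Real.exp (β * F x) *
          ∑ j ∈ Finset.Icc 1 n, Real.exp (β * S T F (j : ℤ) (T x)) + Real.exp (β * F x)) :=
        mul_le_mul_of_nonneg_right hle (by positivity)
    _ = _ := by ring

/-! ### Invariant densities and coboundaries -/

namespace IsConformal

variable {X : Type*} [MeasurableSpace X] {φ : X ≃ᵐ X} {F : X → ℝ} {β : ℝ} {m : Measure X}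

lemma map_symm_withDensity (hm : IsConformal φ.toEquiv F β m) (hF : Measurable F)
    {g : X → ℝ≥0∞} (hg : Measurable g) :
    (m.withDensity g).map φ.symm
      = m.withDensity fun x => ENNReal.ofReal (Real.exp (β * F x)) * g (φ x) := by
  ext B hB
  have hB' : MeasurableSet (φ.symm ⁻¹' B) := φ.symm.measurable hB
  rw [Measure.map_apply φ.symm.measurable hB, withDensity_apply _ hB', withDensity_apply _ hB,
    ← lintegral_indicator hB', ← lintegral_indicator hB,
    ← hm.lintegral_comp_mul hF (hg.indicator hB')]
  refine lintegral_congr fun x => ?_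
  by_cases hx : x ∈ B
  · rw [Set.indicator_of_mem hx, Set.indicator_of_mem (by simpa using hx)]
  · rw [Set.indicator_of_notMem hx, Set.indicator_of_notMem (by simpa using hx), mul_zero]

/-- The measure with density `g` is invariant if and only if `g` satisfies the cocycle
equation. -/
lemma measurePreserving_withDensity_iff (hm : IsConformal φ.toEquiv F β m) (hF : Measurable F)
    {g : X → ℝ≥0∞} (hg : Measurable g) :
    MeasurePreserving φ (m.withDensity g) (m.withDensity g) ↔
      ∀ᵐ x ∂m, ENNReal.ofReal (Real.exp (β * F x)) * g (φ x) = g x := by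
  have := hm.prob
  have hcg : Measurable fun x => ENNReal.ofReal (Real.exp (β * F x)) * g (φ x) :=
    (measurable_density hF).mul (hg.comp φ.measurable)
  have key := withDensity_eq_iff_of_sigmaFinite (μ := m) hcg.aemeasurable hg.aemeasurable
  rw [← hm.map_symm_withDensity hF hg] at key
  refine Iff.trans ⟨fun h => ?_, fun h => ?_⟩ key
  · exact (MeasurePreserving.symm φ h).map_eq
  · have : MeasurePreserving φ.symm (m.withDensity g) (m.withDensity g) := ⟨φ.symm.measurable, h⟩
    exact MeasurePreserving.symm φ.symm this

lemma measurePreserving_of_coboundary (hm : IsConformal φ.toEquiv F β m) (hF : Measurable F)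
    {u : X → ℝ} (hu : Measurable u) (hc : ∀ᵐ x ∂m, β * F x = u (φ x) - u x) :
    MeasurePreserving φ (m.withDensity fun x => ENNReal.ofReal (Real.exp (-u x)))
      (m.withDensity fun x => ENNReal.ofReal (Real.exp (-u x))) := by
  have hu' : Measurable fun x => Real.exp (-u x) := Real.measurable_exp.comp hu.neg
  rw [hm.measurePreserving_withDensity_iff hF hu'.ennreal_ofReal]
  filter_upwards [hc] with x hx
  rw [← ENNReal.ofReal_mul (Real.exp_pos _).le, ← Real.exp_add, hx]
  congr 2
  ring

end IsConformal

section Density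

variable {X : Type*} [MeasurableSpace X] {m : Measure X}

lemma equivalent_withDensity_exp {u : X → ℝ} (hu : Measurable u) :
    Equivalent m (m.withDensity fun x => ENNReal.ofReal (Real.exp (-u x))) :=
  ⟨withDensity_absolutelyContinuous' (Real.measurable_exp.comp hu.neg).ennreal_ofReal.aemeasurable
    (ae_of_all _ fun _ => (ENNReal.ofReal_pos.2 (Real.exp_pos _)).ne'),
    withDensity_absolutelyContinuous _ _⟩

lemma sigmaFinite_withDensity_exp [SigmaFinite m] (u : X → ℝ) :
    SigmaFinite (m.withDensity fun x => ENNReal.ofReal (Real.exp (-u x))) :=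
  SigmaFinite.withDensity_ofReal _

lemma Equivalent.nullSingletonClass {ν : Measure X} (h : m ≪ ν) [NullSingletonClass ν] :
    NullSingletonClass m :=
  ⟨fun x => h (measure_singleton x)⟩

end Density

namespace IsConformal

variable {X : Type*} [MeasurableSpace X] {φ : X ≃ᵐ X} {F : X → ℝ} {β : ℝ} {m : Measure X}

/-- Take $u=-\log g$ and the logarithm of the cocycle equation. Quasi-invariance makes `g` positive
and finite at `φ x` as well. -/
lemma exists_coboundary_of_density (hm : IsConformal φ.toEquiv F β m) (hF : Measurable F)
    {g : X → ℝ≥0∞} (hg : Measurable g) (hpos : ∀ᵐ x ∂m, 0 < g x) (hfin : ∀ᵐ x ∂m, g x < ∞)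
    (hc : ∀ᵐ x ∂m, ENNReal.ofReal (Real.exp (β * F x)) * g (φ x) = g x) :
    ∃ u : X → ℝ, Measurable u ∧ (∀ᵐ x ∂m, β * F x = u (φ x) - u x) ∧
      m.withDensity (fun x => ENNReal.ofReal (Real.exp (-u x))) = m.withDensity g := by
  have hq := hm.quasiMeasurePreserving hF
  refine ⟨fun x => -Real.log (g x).toReal, (Real.measurable_log.comp hg.ennreal_toReal).neg,
    ?_, ?_⟩
  · filter_upwards [hpos, hfin, hq.ae hpos, hq.ae hfin, hc] with x h1 h2 h3 h4 h5
    have h6 := congrArg (fun t => Real.log t.toReal) h5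
    simp only [ENNReal.toReal_mul, ENNReal.toReal_ofReal (Real.exp_pos _).le] at h6
    rw [Real.log_mul (Real.exp_pos _).ne' (ENNReal.toReal_pos h3.ne' h4.ne).ne',
      Real.log_exp] at h6
    linarith
  · refine withDensity_congr_ae ?_
    filter_upwards [hpos, hfin] with x h1 h2
    rw [neg_neg, Real.exp_log (ENNReal.toReal_pos h1.ne' h2.ne), ENNReal.ofReal_toReal h2.ne]

/-- An equivalent `σ`-finite invariant measure makes `βF` a coboundary almost everywhere. -/
lemma exists_coboundary_of_invariant (hm : IsConformal φ.toEquiv F β m) (hF : Measurable F)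
    {ν : Measure X} [SigmaFinite ν] (hν : MeasurePreserving φ ν ν) (he : Equivalent m ν) :
    ∃ u : X → ℝ, Measurable u ∧ (∀ᵐ x ∂m, β * F x = u (φ x) - u x) ∧
      m.withDensity (fun x => ENNReal.ofReal (Real.exp (-u x))) = ν := by
  have := hm.prob
  have hg := Measure.measurable_rnDeriv ν m
  have hd : m.withDensity (ν.rnDeriv m) = ν := Measure.withDensity_rnDeriv_eq ν m he.2
  obtain ⟨u, h1, h2, h3⟩ := hm.exists_coboundary_of_density hF hg
    (Measure.rnDeriv_pos' he.1) (Measure.rnDeriv_lt_top ν m)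
    ((hm.measurePreserving_withDensity_iff hF hg).1 (by rwa [hd]))
  exact ⟨u, h1, h2, h3.trans hd⟩

/-- The difference of two solutions is invariant a.e., hence constant. Equivalent σ-finite invariant
measures are thus proportional, and a finite one excludes an infinite one. -/
lemma coboundary_unique (hm : IsConformal φ.toEquiv F β m) (hF : Measurable F)
    (herg : PreErgodic φ m)
    {u v : X → ℝ} (hu : Measurable u) (hv : Measurable v)
    (hcu : ∀ᵐ x ∂m, β * F x = u (φ x) - u x) (hcv : ∀ᵐ x ∂m, β * F x = v (φ x) - v x) :
    ∃ c, ∀ᵐ x ∂m, u x = v x + c := by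
  obtain ⟨c, hc⟩ := (hm.quasiErgodic hF herg).ae_eq_const_of_ae_eq_comp₀ (g := fun x => u x - v x)
    (hu.sub hv).nullMeasurable (by
      filter_upwards [hcu, hcv] with x h1 h2
      simp only [Function.comp]
      linarith)
  refine ⟨c, ?_⟩
  filter_upwards [hc] with x hx
  simp only [Function.const] at hx
  linarith

/-- $S_{n+1}(F)=F+S_n(F)\circ\phi$, so each step of the induction is one change of variables. -/
lemma lintegral_exp_S (hm : IsConformal φ.toEquiv F β m) (hF : Measurable F) (n : ℕ) :
    ∫⁻ x, ENNReal.ofReal (Real.exp (β * S φ.toEquiv F n x)) ∂m = 1 := by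
  have := hm.prob
  induction n with
  | zero => simp
  | succ n ih =>
    rw [← ih, ← hm.lintegral_comp_mul hF (measurable_exp_S β hF n).ennreal_ofReal]
    refine lintegral_congr fun x => ?_
    have h := S_add φ.toEquiv F n 1 x
    rw [S_one, zpow_one] at h
    push_cast
    rw [h, mul_add, Real.exp_add, ENNReal.ofReal_mul (Real.exp_pos _).le]
    rfl

lemma lintegral_lowerDensity_le (hm : IsConformal φ.toEquiv F β m) (hF : Measurable F) :
    ∫⁻ x, lowerDensity φ.toEquiv F β x ∂m ≤ 1 := by
  refine (lintegral_liminf_le fun n => measurable_average β hF n).trans ?_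
  refine (liminf_le_limsup).trans (limsup_le_of_le (by isBoundedDefault) (.of_forall fun n => ?_))
  have hmeas (j : ℕ) : Measurable fun x =>
      ENNReal.ofReal (Real.exp (β * S φ.toEquiv F (j : ℤ) x)) :=
    (measurable_exp_S β hF j).ennreal_ofReal
  simp_rw [ENNReal.ofReal_mul (show (0 : ℝ) ≤ 1 / n by positivity),
    ENNReal.ofReal_sum_of_nonneg fun j _ => (Real.exp_pos _).le]
  rw [lintegral_const_mul _ (Finset.measurable_sum _ fun j _ => hmeas j),
    lintegral_finsetSum _ fun j _ => hmeas j]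
  simp_rw [hm.lintegral_exp_S hF]
  rcases n.eq_zero_or_pos with rfl | hn
  · simp
  · have hn' : (0 : ℝ) < n := by exact_mod_cast hn
    rw [Finset.sum_const, Nat.card_Icc, nsmul_one, Nat.add_sub_cancel, ← ENNReal.ofReal_natCast,
      ← ENNReal.ofReal_mul (by positivity), one_div_mul_cancel hn'.ne', ENNReal.ofReal_one]

/-- The pointwise inequality `lowerDensity_le` compares two functions with the same finite integral.
-/
lemma ae_lowerDensity_eq (hm : IsConformal φ.toEquiv F β m) (hF : Measurable F) :
    ∀ᵐ x ∂m, ENNReal.ofReal (Real.exp (β * F x)) * lowerDensity φ.toEquiv F β (φ x)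
      = lowerDensity φ.toEquiv F β x := by
  have hmeas : Measurable (lowerDensity φ.toEquiv F β) := measurable_lowerDensity hF
  have h := ae_eq_of_ae_le_of_lintegral_le (μ := m) (f := lowerDensity φ.toEquiv F β)
    (ae_of_all _ fun x => lowerDensity_le φ.toEquiv F β x)
    ((hm.lintegral_lowerDensity_le hF).trans_lt ENNReal.one_lt_top).ne
    ((measurable_density hF).mul (hmeas.comp φ.measurable)).aemeasurable
    (hm.lintegral_comp_mul hF hmeas).le
  filter_upwards [h] with x hx
  exact hx.symm

lemma ae_lowerDensity_pos_or (hm : IsConformal φ.toEquiv F β m) (hF : Measurable F)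
    (herg : PreErgodic φ m) :
    (∀ᵐ x ∂m, 0 < lowerDensity φ.toEquiv F β x) ∨ ∀ᵐ x ∂m, ¬ 0 < lowerDensity φ.toEquiv F β x := by
  refine (hm.quasiErgodic hF herg).ae_mem_or_ae_notMem₀
    (s := {x | 0 < lowerDensity φ.toEquiv F β x})
    (measurableSet_lt measurable_const (measurable_lowerDensity hF)).nullMeasurableSet ?_
  refine Filter.Eventually.set_eq ?_
  filter_upwards [hm.ae_lowerDensity_eq hF] with x hx
  simp only [Set.mem_preimage, Set.mem_ofPred_eq]
  rw [← hx]
  simp [Real.exp_pos]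

/-- If the lower density is positive there is an equivalent finite invariant measure. -/
lemma exists_coboundary_of_lowerDensity_pos (hm : IsConformal φ.toEquiv F β m)
    (hF : Measurable F) (hpos : ∀ᵐ x ∂m, 0 < lowerDensity φ.toEquiv F β x) :
    ∃ u : X → ℝ, Measurable u ∧ (∀ᵐ x ∂m, β * F x = u (φ x) - u x) ∧
      m.withDensity (fun x => ENNReal.ofReal (Real.exp (-u x))) Set.univ < ∞ := by
  have hmeas : Measurable (lowerDensity φ.toEquiv F β) := measurable_lowerDensity hF
  have hlt := (hm.lintegral_lowerDensity_le hF).trans_lt ENNReal.one_lt_top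
  obtain ⟨u, h1, h2, h3⟩ := hm.exists_coboundary_of_density hF hmeas hpos
    (ae_lt_top hmeas hlt.ne) (hm.ae_lowerDensity_eq hF)
  refine ⟨u, h1, h2, ?_⟩
  rwa [h3, withDensity_apply _ .univ, setLIntegral_univ]

/-- If there is an equivalent finite invariant measure then the lower density is positive. -/
lemma lowerDensity_pos_of_coboundary (hm : IsConformal φ.toEquiv F β m) (hF : Measurable F)
    (herg : PreErgodic φ m) {u : X → ℝ} (hu : Measurable u)
    (hc : ∀ᵐ x ∂m, β * F x = u (φ x) - u x)
    (hfin : m.withDensity (fun x => ENNReal.ofReal (Real.exp (-u x))) Set.univ < ∞) :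
    ∀ᵐ x ∂m, 0 < lowerDensity φ.toEquiv F β x := by
  have := hm.prob
  refine (hm.ae_lowerDensity_pos_or hF herg).resolve_right fun hzero => ?_
  have hinv := hm.measurePreserving_of_coboundary hF hu hc
  have heq := equivalent_withDensity_exp (m := m) hu
  set ν := m.withDensity fun x => ENNReal.ofReal (Real.exp (-u x))
  have : IsFiniteMeasure ν := ⟨hfin⟩
  have hν0 : 0 < ν Set.univ := by
    rw [pos_iff_ne_zero]
    intro h
    have := heq.1 h
    simp at this
  have hB (K : ℕ) : MeasurableSet {x | (K : ℝ) < Real.exp (-u x)} :=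
    measurableSet_lt measurable_const (Real.measurable_exp.comp hu.neg)
  have hlim : Tendsto (fun K : ℕ => 2 * ν {x | (K : ℝ) < Real.exp (-u x)}) atTop (nhds 0) := by
    have h1 := tendsto_measure_iInter_atTop (μ := ν) (fun K => (hB K).nullMeasurableSet)
      (fun a b hab x (hx : (b : ℝ) < _) => lt_of_le_of_lt (Nat.cast_le.2 hab) hx) ⟨0, measure_ne_top _ _⟩
    have h2 : ⋂ K : ℕ, {x | (K : ℝ) < Real.exp (-u x)} = ∅ := by
      ext x
      simp only [Set.mem_iInter, Set.mem_empty_iff_false, iff_false, not_forall]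
      obtain ⟨K, hK⟩ := exists_nat_ge (Real.exp (-u x))
      exact ⟨K, not_lt.2 hK⟩
    rw [h2, measure_empty] at h1
    simpa using ENNReal.Tendsto.const_mul (a := 2) h1 (Or.inr (by simp))
  -- `K` is chosen with `2 * ν B < ν univ`, so the maximal inequality leaves a set of positive
  -- measure outside `E`.
  obtain ⟨K, hK, hK0⟩ := ((hlim.eventually (gt_mem_nhds hν0)).and (eventually_gt_atTop 0)).exists
  have hK0' : (0 : ℝ) < K := by exact_mod_cast hK0
  have hmax := (measure_exists_birkhoffSum_pos_le hinv (hB K)).trans_lt hK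
  set B := {x | (K : ℝ) < Real.exp (-u x)}
  set E := {x | ∃ n, 0 < birkhoffSum φ (fun x => B.indicator 1 x - 1 / 2 : X → ℝ) n x}
  -- The averages in the lower density start at `j = 1`, Birkhoff sums at `0`. Evaluating at `φ.symm
  -- y` aligns the two.
  have hcob : ∀ᵐ y ∂m, ∀ n : ℕ,
      β * S φ.toEquiv F n (φ.symm y) = u (φ^[n] (φ.symm y)) - u (φ.symm y) := by
    refine hm.quasiMeasurePreserving_symm.ae (p := fun x => ∀ n : ℕ,
      β * S φ.toEquiv F n x = u (φ^[n] x) - u x) (ae_all_iff.2 fun n => ?_)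
    have h := ae_all_iff.2 fun j : ℕ => ((hm.quasiMeasurePreserving hF).iterate j).ae hc
    filter_upwards [h] with x hx
    induction n with
    | zero => simp
    | succ n ih =>
      have := hx n
      rw [S_natCast, Finset.sum_range_succ, ← S_natCast, mul_add, ih, Function.iterate_succ_apply']
      rw [show β * F (φ.toEquiv^[n] x) = β * F (φ^[n] x) from rfl, this]
      ring
  have hgood : ∃ y ∉ E, (¬ 0 < lowerDensity φ.toEquiv F β (φ.symm y)) ∧
      ∀ n : ℕ, β * S φ.toEquiv F n (φ.symm y) = u (φ^[n] (φ.symm y)) - u (φ.symm y) := by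
    by_contra! hall
    have h := heq.2.ae_le ((hm.quasiMeasurePreserving_symm.ae hzero).and hcob)
    have hE : E =ᵐ[ν] Set.univ := by
      rw [eventuallyEq_univ]
      filter_upwards [h] with y hy
      by_contra hyE
      obtain ⟨n, hn⟩ := hall y hyE (not_lt.1 hy.1)
      exact hn (hy.2 n)
    rw [measure_congr hE] at hmax
    exact lt_irrefl _ hmax
  obtain ⟨y, hyE, hy0, hyc⟩ := hgood
  refine hy0 ?_
  set x := φ.symm y
  have hxy (i : ℕ) : φ^[i + 1] x = φ^[i] y := by
    rw [Function.iterate_succ_apply, φ.apply_symm_apply]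
  -- Outside `B` one has $e^{u}\ge 1/K$, so the weight is at least $e^{-u(x)}/K$; inside `B` the
  -- bound is 0.
  have hterm (i : ℕ) : Real.exp (-u x) / K * (1 - B.indicator 1 (φ^[i] y))
      ≤ Real.exp (β * S φ.toEquiv F ((i + 1 : ℕ) : ℤ) x) := by
    rw [hyc, hxy]
    by_cases hB : φ^[i] y ∈ B
    · rw [Set.indicator_of_mem hB]
      simpa using (Real.exp_pos _).le
    · rw [Set.indicator_of_notMem hB, sub_zero, mul_one, sub_eq_add_neg, Real.exp_add,
        div_le_iff₀ hK0']
      have h1 : Real.exp (-u (φ^[i] y)) ≤ K := not_lt.1 hB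
      have h2 : 1 ≤ Real.exp (u (φ^[i] y)) * K := by
        calc (1 : ℝ) = Real.exp (u (φ^[i] y)) * Real.exp (-u (φ^[i] y)) := by
              rw [← Real.exp_add]; simp
          _ ≤ _ := mul_le_mul_of_nonneg_left h1 (Real.exp_pos _).le
      nlinarith [Real.exp_pos (-u x)]
  have hbound : ENNReal.ofReal (Real.exp (-u x) / K * (1 / 2)) ≤ lowerDensity φ.toEquiv F β x := by
    refine le_liminf_of_le (by isBoundedDefault) ?_
    filter_upwards [eventually_gt_atTop 0] with n hn
    have hn' : (0 : ℝ) < n := by exact_mod_cast hn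
    refine ENNReal.ofReal_le_ofReal ?_
    have h1 : birkhoffSum φ (fun x => B.indicator 1 x - 1 / 2 : X → ℝ) n y ≤ 0 :=
      not_lt.1 fun h => hyE ⟨n, h⟩
    have h2 : (n : ℝ) / 2 ≤ ∑ i ∈ Finset.range n, (1 - B.indicator 1 (φ^[i] y) : ℝ) := by
      simp only [birkhoffSum, Finset.sum_sub_distrib, Finset.sum_const, Finset.card_range,
        nsmul_eq_mul, mul_one] at h1 ⊢
      linarith
    rw [sum_Icc_one, one_div_mul_eq_div, le_div_iff₀ hn']
    calc Real.exp (-u x) / K * (1 / 2) * n = Real.exp (-u x) / K * (n / 2) := by ring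
      _ ≤ Real.exp (-u x) / K * ∑ i ∈ Finset.range n, (1 - B.indicator 1 (φ^[i] y) : ℝ) :=
        mul_le_mul_of_nonneg_left h2 (by positivity)
      _ ≤ _ := by
        rw [Finset.mul_sum]
        exact Finset.sum_le_sum fun i _ => hterm i
  exact lt_of_lt_of_le (ENNReal.ofReal_pos.2 (by positivity)) hbound

/-- If `βF` is a coboundary almost everywhere, then `M_{III}` can be chosen to be a null set. -/
lemma exists_isMIII_null (hm : IsConformal φ.toEquiv F β m) (hF : Measurable F)
    {u : X → ℝ} (hu : Measurable u) (hc : ∀ᵐ x ∂m, β * F x = u (φ x) - u x) :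
    ∃ M, IsMIII φ.toEquiv F β m M ∧ m M = 0 := by
  have hG : MeasurableSet {x | β * F x = u (φ x) - u x} :=
    measurableSet_eq_fun (hF.const_mul β) ((hu.comp φ.measurable).sub hu)
  obtain ⟨A, hAG, hA, hinv, hA0⟩ := exists_invariant_subset (hm.quasiMeasurePreserving hF)
    hm.quasiMeasurePreserving_symm hG hc
  refine ⟨Aᶜ, ⟨hA.compl, ?_, ⟨u, hu, fun x hx => hAG (by simpa using hx)⟩,
    fun B hB _ _ _ => measure_mono_null hB hA0⟩, hA0⟩
  rw [Set.preimage_compl]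
  exact congrArg _ hinv

/-- A measure which is not singular to some `σ`-finite invariant measure is equivalent to one. -/
lemma exists_equivalent_of_not_mutuallySingular (hm : IsConformal φ.toEquiv F β m)
    (hF : Measurable F) (herg : PreErgodic φ m) {ν : Measure X} [SigmaFinite ν]
    (hν : MeasurePreserving φ ν ν) (h : ¬ m ⟂ₘ ν) :
    ∃ ν' : Measure X, SigmaFinite ν' ∧ MeasurePreserving φ ν' ν' ∧ Equivalent m ν' := by
  have := hm.prob
  obtain ⟨N, hN, hN1, hN2⟩ := Measure.mutuallySingular_singularPart ν m
  -- On an invariant `m`-conull set that is null for the singular part, `ν` is invariant and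
  -- absolutely continuous; it is nonzero there because `m` and `ν` are not singular.
  obtain ⟨A, hAN, hA, hinv, hA0⟩ := exists_invariant_subset (hm.quasiMeasurePreserving hF)
    hm.quasiMeasurePreserving_symm hN hN2
  have hpres : MeasurePreserving φ (ν.restrict A) (ν.restrict A) := by
    have := hν.restrict_preimage hA
    rwa [hinv] at this
  have hac : ν.restrict A ≪ m := by
    have hd : ν = ν.singularPart m + m.withDensity (ν.rnDeriv m) :=
      ν.haveLebesgueDecomposition_add m
    have hz : (ν.singularPart m).restrict A = 0 :=
      Measure.restrict_eq_zero.2 (measure_mono_null hAN hN1)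
    rw [hd, Measure.restrict_add, hz, zero_add]
    exact Measure.absolutelyContinuous_of_le Measure.restrict_le_self |>.trans
      (withDensity_absolutelyContinuous _ _)
  refine ⟨ν.restrict A, inferInstance, hpres,
    absolutelyContinuous_of_invariant herg hpres hac fun h0 => h ?_, hac⟩
  exact ⟨Aᶜ, hA.compl, hA0, by rw [compl_compl]; exact Measure.restrict_eq_zero.1 h0⟩

theorem isTypeIII_iff (hm : IsConformal φ.toEquiv F β m) (hF : Measurable F)
    (herg : PreErgodic φ m) :
    IsTypeIII φ.toEquiv F β m ↔
      ∀ ν : Measure X, SigmaFinite ν → MeasurePreserving φ ν ν → m ⟂ₘ ν := by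
  have := hm.prob
  constructor
  · rintro ⟨M, hM, h⟩ ν hσ hν
    by_contra hns
    obtain ⟨ν', _, hν', heq⟩ := hm.exists_equivalent_of_not_mutuallySingular hF herg hν hns
    obtain ⟨u, hu, hc, -⟩ := hm.exists_coboundary_of_invariant hF hν' heq
    have hG : MeasurableSet {x | β * F x = u (φ x) - u x} :=
      measurableSet_eq_fun (hF.const_mul β) ((hu.comp φ.measurable).sub hu)
    obtain ⟨A, hAG, hA, hinv, hA0⟩ := exists_invariant_subset (hm.quasiMeasurePreserving hF)
      hm.quasiMeasurePreserving_symm hG hc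
    have h1 : m (A ∩ M) = 0 := hM.null_of_sub _ Set.inter_subset_right
      (hA.inter hM.measurableSet)
      (by rw [Set.preimage_inter, hM.invariant]; exact congrArg (· ∩ M) hinv)
      ⟨u, hu, fun x hx => hAG hx.1⟩
    have h2 : m M ≤ m (A ∩ M) + m Aᶜ := by
      refine (measure_mono fun x hx => ?_).trans (measure_union_le _ _)
      by_cases hxA : x ∈ A
      exacts [Or.inl ⟨hxA, hx⟩, Or.inr hxA]
    rw [h, h1, hA0, add_zero] at h2
    exact absurd h2 (by simp)
  · intro hall
    -- The whole space serves as $M_{III}$: an invariant set of positive measure carrying a solution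
    -- `u` would be conull, and $e^{-u}m$ would be an equivalent invariant measure.
    refine ⟨Set.univ, ⟨.univ, rfl, ⟨0, measurable_zero, by simp⟩, ?_⟩, measure_univ⟩
    rintro A - hA hinv ⟨u, hu, hc⟩
    by_contra hA0
    have hA1 := (herg.prob_eq_zero_or_one hA hinv).resolve_left hA0
    have hc' : ∀ᵐ x ∂m, β * F x = u (φ x) - u x := by
      have : ∀ᵐ x ∂m, x ∈ A := (prob_compl_eq_zero_iff hA).2 hA1
      filter_upwards [this] with x hx
      exact hc x hx
    have hs := hall _ (sigmaFinite_withDensity_exp u)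
      (hm.measurePreserving_of_coboundary hF hu hc')
    have h0 : m = 0 := Measure.MutuallySingular.self_iff m |>.1
      (hs.mono_ac .rfl (equivalent_withDensity_exp hu).1)
    exact IsProbabilityMeasure.ne_zero m h0

end IsConformal

/-! ### The characterisations of the types -/

namespace IsConformal

variable {X : Type*} [MeasurableSpace X] [StandardBorelSpace X] {φ : X ≃ᵐ X} {F : X → ℝ}
  {β : ℝ} {m : Measure X}

/-- At an atom of period $p$ one has $\beta S_p(F)=0$, which forces cyclicity unless β = 0; an
infinite atomic orbit is summable. -/
lemma mem_MI_or_not_isFCyclic (hm : IsConformal φ.toEquiv F β m) {x : X} (hx : m {x} ≠ 0) :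
    x ∈ MI φ.toEquiv F β ∨
      (β = 0 ∧ x ∈ Function.periodicPts φ.toEquiv ∧ ¬ IsFCyclic φ.toEquiv F x) := by
  by_cases hper : x ∈ Function.periodicPts φ.toEquiv
  · by_cases hcyc : IsFCyclic φ.toEquiv F x
    · have hpos := Function.minimalPeriod_pos_of_mem_periodicPts hper
      refine Or.inl (Or.inr (Set.mem_biUnion (show _ ∈ Set.Ici 1 from hpos) ?_))
      exact (mem_MIp_iff hpos).2 ⟨hcyc, rfl⟩
    · refine Or.inr ⟨?_, hper, hcyc⟩
      have hit : φ.toEquiv^[Function.minimalPeriod φ.toEquiv x] x = x :=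
        Function.iterate_minimalPeriod
      refine (mul_eq_zero.1 (hm.mul_S_eq_zero hx hit)).resolve_right fun h => hcyc ⟨hper, ?_⟩
      rw [sum_Icc_eq_S hit, h]
  · exact Or.inl (Or.inl (hm.mem_MIinf_of_orbit_infinite hx (mt orbit_finite_iff.1 hper)))

lemma measure_singleton_ne_zero_of_orbit (hm : IsConformal φ.toEquiv F β m) {x : X}
    (hx : m (orbit φ.toEquiv x) = 1) : m {x} ≠ 0 := by
  intro h
  have h0 : m (orbit φ.toEquiv x) = 0 := by
    refine (measure_null_iff_singleton (countable_orbit _ x)).2 ?_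
    rintro _ ⟨k, rfl⟩
    change m {((φ.toEquiv : Equiv.Perm X) ^ k) x} = 0
    rw [hm.measure_singleton_zpow, h, mul_zero]
  simp [h0] at hx

lemma isAtomic_of_orbit (hm : IsConformal φ.toEquiv F β m) {x : X}
    (hx : m (orbit φ.toEquiv x) = 1) : IsAtomic m := by
  have := hm.prob
  exact ⟨_, countable_orbit _ x,
    (prob_compl_eq_zero_iff (countable_orbit _ x).measurableSet).2 hx⟩

theorem isTypeIp_iff (hm : IsConformal φ.toEquiv F β m) (hF : Measurable F)
    (herg : PreErgodic φ m) {p : ℕ} (hp : 1 ≤ p) :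
    IsTypeIp φ.toEquiv F m p ↔ IsAtomic m ∧ ∃ x : X, IsFCyclic φ.toEquiv F x ∧
      Function.minimalPeriod φ x = p ∧ m (orbit φ.toEquiv x) = 1 := by
  have := hm.prob
  constructor
  · intro h
    obtain ⟨x, hx, hx0⟩ := hm.exists_atom_of_MIp hF herg hp
      (by rw [IsTypeIp] at h; rw [h]; exact one_ne_zero)
    have ho := measure_orbit_eq_one herg hx0
    obtain ⟨h1, h2⟩ := (mem_MIp_iff hp).1 hx
    exact ⟨hm.isAtomic_of_orbit ho, x, h1, h2, ho⟩
  · rintro ⟨-, x, h1, h2, h3⟩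
    refine le_antisymm prob_le_one (h3.symm.le.trans (measure_mono ?_))
    rintro _ ⟨k, rfl⟩
    exact zpow_mem_MIp ((mem_MIp_iff hp).2 ⟨h1, h2⟩) k

theorem isTypeIinf_iff (hm : IsConformal φ.toEquiv F β m) (hF : Measurable F)
    (herg : PreErgodic φ m) :
    IsTypeIinf φ.toEquiv F β m ↔ IsAtomic m ∧ ∃ x : X, (orbit φ.toEquiv x).Infinite ∧
      m (orbit φ.toEquiv x) = 1 := by
  have := hm.prob
  constructor
  · intro h
    obtain ⟨x, hx, hx0⟩ := hm.exists_atom_of_MIinf hF herg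
      (by rw [IsTypeIinf] at h; rw [h]; exact one_ne_zero)
    have ho := measure_orbit_eq_one herg hx0
    exact ⟨hm.isAtomic_of_orbit ho, x,
      fun hfin => notMem_periodicPts_of_mem_MIinf hx (orbit_finite_iff.1 hfin), ho⟩
  · rintro ⟨-, x, h1, h2⟩
    refine le_antisymm prob_le_one (h2.symm.le.trans (measure_mono ?_))
    rintro _ ⟨k, rfl⟩
    exact zpow_mem_MIinf
      (hm.mem_MIinf_of_orbit_infinite (hm.measure_singleton_ne_zero_of_orbit h2) h1) k

/-- For a non-atomic measure, type `II_1` means positivity of the lower density. -/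
lemma isTypeII1_iff_lowerDensity_pos [NullSingletonClass m] (hm : IsConformal φ.toEquiv F β m)
    (hF : Measurable F) (herg : PreErgodic φ m) :
    IsTypeII1 φ.toEquiv F β m ↔ ∀ᵐ x ∂m, 0 < lowerDensity φ.toEquiv F β x := by
  have := hm.prob
  rw [IsTypeII1, MII1_eq, measure_sdiff_null (hm.measure_MI_eq_zero hF herg),
    ← prob_compl_eq_zero_iff (measurableSet_lt measurable_const (measurable_lowerDensity hF))]
  rfl

theorem isTypeII1_iff (hm : IsConformal φ.toEquiv F β m) (hF : Measurable F)
    (herg : PreErgodic φ m)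
    (hβ : β = 0 → ∀ x ∈ Function.periodicPts φ, m (orbit φ.toEquiv x) = 1 →
      IsFCyclic φ.toEquiv F x) :
    IsTypeII1 φ.toEquiv F β m ↔ ∃ ν : Measure X, IsProbabilityMeasure ν ∧
      NullSingletonClass ν ∧ MeasurePreserving φ ν ν ∧ Equivalent m ν := by
  have := hm.prob
  constructor
  · intro h
    have hna : NullSingletonClass m := by
      refine ⟨fun x => ?_⟩
      by_contra hx
      rcases hm.mem_MI_or_not_isFCyclic hx with hMI | ⟨h1, h2, h3⟩
      · refine hx (measure_mono_null (Set.singleton_subset_iff.2 ?_)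
          ((prob_compl_eq_zero_iff (measurableSet_MII1 hF)).2 h))
        exact fun h' => h'.2 hMI
      · exact h3 (hβ h1 x h2 (measure_orbit_eq_one herg hx))
    obtain ⟨u, hu, hc, hfin⟩ := hm.exists_coboundary_of_lowerDensity_pos hF
      ((hm.isTypeII1_iff_lowerDensity_pos hF herg).1 h)
    have hinv := hm.measurePreserving_of_coboundary hF hu hc
    have heq := equivalent_withDensity_exp (m := m) hu
    set ν := m.withDensity fun x => ENNReal.ofReal (Real.exp (-u x))
    have hν0 : ν Set.univ ≠ 0 := by
      intro h
      have := heq.1 h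
      simp at this
    have hc0 : (ν Set.univ)⁻¹ ≠ 0 := ENNReal.inv_ne_zero.2 hfin.ne
    have hac : (ν Set.univ)⁻¹ • ν ≪ m := heq.2.smul_left _
    have hac' : m ≪ (ν Set.univ)⁻¹ • ν :=
      heq.1.trans (Measure.absolutelyContinuous_smul hc0)
    refine ⟨(ν Set.univ)⁻¹ • ν, ⟨?_⟩, Equivalent.nullSingletonClass hac, ?_, hac', hac⟩
    · rw [Measure.smul_apply, smul_eq_mul, ENNReal.inv_mul_cancel hν0 hfin.ne]
    · exact hinv.smul_measure _
  · rintro ⟨ν, hν, hna, hinv, heq⟩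
    have : NullSingletonClass m := Equivalent.nullSingletonClass heq.1
    obtain ⟨u, hu, hc, hd⟩ := hm.exists_coboundary_of_invariant hF hinv heq
    exact (hm.isTypeII1_iff_lowerDensity_pos hF herg).2
      (hm.lowerDensity_pos_of_coboundary hF herg hu hc (by rw [hd]; exact measure_lt_top _ _))

theorem isTypeIIinf_iff (hm : IsConformal φ.toEquiv F β m) (hF : Measurable F)
    (herg : PreErgodic φ m) :
    IsTypeIIinf φ.toEquiv F β m ↔ ∃ ν : Measure X, SigmaFinite ν ∧ ν Set.univ = ∞ ∧
      NullSingletonClass ν ∧ MeasurePreserving φ ν ν ∧ Equivalent m ν := by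
  have := hm.prob
  constructor
  · rintro ⟨M, hM, h⟩
    have h0 : m (MI φ.toEquiv F β ∪ MII1 φ.toEquiv F β ∪ M) = 0 := by
      have hmeas : MeasurableSet (MI φ.toEquiv F β ∪ MII1 φ.toEquiv F β ∪ M) :=
        ((measurableSet_MI hF).union (measurableSet_MII1 hF)).union hM.measurableSet
      rw [← compl_compl (MI φ.toEquiv F β ∪ MII1 φ.toEquiv F β ∪ M)]
      exact (prob_compl_eq_zero_iff hmeas.compl).2 h
    have h1 : m (MI φ.toEquiv F β ∪ MII1 φ.toEquiv F β) = 0 :=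
      measure_mono_null Set.subset_union_left h0
    have h2 : m M = 0 := measure_mono_null Set.subset_union_right h0
    have hna : NullSingletonClass m := by
      refine ⟨fun x => ?_⟩
      by_contra hx
      refine hx (measure_mono_null (Set.singleton_subset_iff.2 ?_) h1)
      by_cases hMI : x ∈ MI φ.toEquiv F β
      · exact Or.inl hMI
      · obtain ⟨rfl, -, -⟩ := (hm.mem_MI_or_not_isFCyclic hx).resolve_left hMI
        exact Or.inr ⟨lowerDensity_zero_pos _ F x, hMI⟩
    obtain ⟨u, hu, hc⟩ := hM.exists_off
    have hc' : ∀ᵐ x ∂m, β * F x = u (φ x) - u x := by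
      filter_upwards [measure_eq_zero_iff_ae_notMem.1 h2] with x hx
      exact hc x hx
    have heq := equivalent_withDensity_exp (m := m) hu
    refine ⟨_, sigmaFinite_withDensity_exp u, ?_, Equivalent.nullSingletonClass heq.2,
      hm.measurePreserving_of_coboundary hF hu hc', heq⟩
    by_contra hne
    have hII := (hm.isTypeII1_iff_lowerDensity_pos hF herg).2
      (hm.lowerDensity_pos_of_coboundary hF herg hu hc' (lt_top_iff_ne_top.2 hne))
    rw [IsTypeII1, measure_mono_null Set.subset_union_right h1] at hII
    exact zero_ne_one hII
  · rintro ⟨ν, hσ, htop, hna, hinv, heq⟩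
    have : NullSingletonClass m := Equivalent.nullSingletonClass heq.1
    obtain ⟨u, hu, hc, hd⟩ := hm.exists_coboundary_of_invariant hF hinv heq
    obtain ⟨M, hM, hM0⟩ := hm.exists_isMIII_null hF hu hc
    refine ⟨M, hM, (prob_compl_eq_one_iff (((measurableSet_MI hF).union
      (measurableSet_MII1 hF)).union hM.measurableSet)).2 ?_⟩
    refine measure_union_null (measure_union_null (hm.measure_MI_eq_zero hF herg) ?_) hM0
    rcases hm.ae_lowerDensity_pos_or hF herg with hpos | hzero
    -- Positive lower density would give a finite invariant measure in the class of `m`, and `ν`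
    -- would be a finite multiple of it.
    · exfalso
      obtain ⟨v, hv, hcv, hfin⟩ := hm.exists_coboundary_of_lowerDensity_pos hF hpos
      obtain ⟨c, huv⟩ := hm.coboundary_unique hF herg hu hv hc hcv
      have hv' : Measurable fun x => ENNReal.ofReal (Real.exp (-v x)) :=
        (Real.measurable_exp.comp hv.neg).ennreal_ofReal
      have : ν = ENNReal.ofReal (Real.exp (-c)) •
          m.withDensity fun x => ENNReal.ofReal (Real.exp (-v x)) := by
        rw [← hd, ← withDensity_smul _ hv']
        refine withDensity_congr_ae ?_
        filter_upwards [huv] with x hx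
        rw [Pi.smul_apply, smul_eq_mul, ← ENNReal.ofReal_mul (Real.exp_pos _).le, ← Real.exp_add,
          hx, neg_add_rev]
      rw [this, Measure.smul_apply, smul_eq_mul] at htop
      exact (ENNReal.mul_lt_top ENNReal.ofReal_lt_top hfin).ne htop
    · exact measure_mono_null (t := {x | 0 < lowerDensity φ.toEquiv F β x}) (fun x hx => hx.1)
        (measure_eq_zero_iff_ae_notMem.2 hzero)

end IsConformal

end ConformalType

theorem theorem4p10 {X : Type*} [MetricSpace X] [CompactSpace X] [MeasurableSpace X]
    [BorelSpace X] (φ : X ≃ₜ X) (F : C(X, ℝ)) (β : ℝ) (m : Measure X)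
    (hm : ConformalType.IsConformal φ.toEquiv F β m) (herg : PreErgodic φ m) :
    (∀ p : ℕ, 1 ≤ p →
      (ConformalType.IsTypeIp φ.toEquiv F m p ↔
        ConformalType.IsAtomic m ∧
          ∃ x : X, ConformalType.IsFCyclic φ.toEquiv F x ∧
            Function.minimalPeriod φ x = p ∧ m (ConformalType.orbit φ.toEquiv x) = 1)) ∧
    (ConformalType.IsTypeIinf φ.toEquiv F β m ↔
      ConformalType.IsAtomic m ∧
        ∃ x : X, (ConformalType.orbit φ.toEquiv x).Infinite ∧
          m (ConformalType.orbit φ.toEquiv x) = 1) ∧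
    ((β = 0 → ∀ x ∈ Function.periodicPts φ, m (ConformalType.orbit φ.toEquiv x) = 1 →
        ConformalType.IsFCyclic φ.toEquiv F x) →
      (ConformalType.IsTypeII1 φ.toEquiv F β m ↔
        ∃ ν : Measure X, IsProbabilityMeasure ν ∧ NullSingletonClass ν ∧ MeasurePreserving φ ν ν ∧
          ConformalType.Equivalent m ν)) ∧
    (ConformalType.IsTypeIIinf φ.toEquiv F β m ↔
      ∃ ν : Measure X, SigmaFinite ν ∧ ν Set.univ = ∞ ∧ NullSingletonClass ν ∧ MeasurePreserving φ ν ν ∧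
        ConformalType.Equivalent m ν) ∧
    (ConformalType.IsTypeIII φ.toEquiv F β m ↔
      ∀ ν : Measure X, SigmaFinite ν → MeasurePreserving φ ν ν → m ⟂ₘ ν) := by
  -- A compact metric space is standard Borel. Beyond this, only the measurability of `F`, of `φ`
  -- and of its inverse is used.
  have hF : Measurable F := F.continuous.measurable
  have hm' : ConformalType.IsConformal φ.toMeasurableEquiv.toEquiv F β m := hm
  have herg' : PreErgodic φ.toMeasurableEquiv m := herg
  exact ⟨fun p hp => hm'.isTypeIp_iff hF herg' hp, hm'.isTypeIinf_iff hF herg',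
    fun hβ => hm'.isTypeII1_iff hF herg' hβ, hm'.isTypeIIinf_iff hF herg',
    hm'.isTypeIII_iff hF herg'⟩
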